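/- Let $k$ be a commutative ring with $\mathbb{Q}\subset k$ (every non-zero integer is invertible in $k$) and let $A$ be a commutative $k$-algebra. Definitions. For $p\in\mathbb{N}$, a co-ideal $\Delta\subset\mathbb{N}^p$ is a non-empty subset such that $\alpha\in\Delta$ and $\alpha'\le\alpha$ imply $\alpha'\in\Delta$. For a (not necessarily commutative) ring $R$, $R[[\mathbf{s}]]_\Delta$ is the quotient of $R[[s_1,\dots,s_p]]$ by the two-sided ideal of the series whose coefficients at all $\alpha\in\Delta$ vanish, and $\mathcal{U}^p(R;\Delta)$ is the group of units of $R[[\mathbf{s}]]_\Delta$ with constant coefficient $1$. $\mathrm{HS}^p_k(A;\Delta)$ is the group (inside $\mathcal{U}^p(\mathrm{End}_k(A);\Delta)$) of the series $D=\sum_{\alpha\in\Delta}D_\alpha\mathbf{s}^\alpha$ with $D_0=\mathrm{Id}$ and $D_\alpha(xy)=\sum_{\beta+\gamma=\alpha}D_\beta(x)D_\gamma(y)$ for all $\alpha\in\Delta$, $x,y\in A$. A substitution map $\varphi:A[[\mathbf{s}]]_\Delta\to A[[\mathbf{t}]]_\Omega$ is an $A$-algebra map such that each $\varphi(s_i)$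 has zero constant coefficient; if $R$ is a $k$-algebra with a $k$-algebra map $\iota: A\to R$ and $r\in R[[\mathbf{s}]]_\Delta$, put $\varphi\bullet r=\sum_\alpha\varphi(\mathbf{s}^\alpha)r_\alpha$. A HS-structure on $R$ over $A/k$ is a family of group homomorphisms $\Psi^p_\Delta:\mathrm{HS}^p_k(A;\Delta)\to\mathcal{U}^p(R;\Delta)$, for all $p\in\mathbb{N}$ and all co-ideals $\Delta\subset\mathbb{N}^p$, such that $\Psi^p_\Delta(D)\,a=\big(\sum_\alpha D_\alpha(a)\mathbf{s}^\alpha\big)\Psi^p_\Delta(D)$ for all $D\in\mathrm{HS}^p_k(A;\Delta)$ and $a\in A$, and $\Psi^q_\Omega(\varphi\bullet D)=\varphi\bullet\Psi^p_\Delta(D)$ for every substitution map $\varphi:A[[\mathbf{s}]]_\Delta\to A[[\mathbf{t}]]_\Omega$ and every $D\in\mathrm{HS}^p_k(A;\Delta)$. A left (resp. right) HS-module over $A/k$ is an $A$-module $E$ with a HS-structure $\Psi$ on $\mathrm{End}_k(E)$ (resp. $\mathrm{End}_k(E)^{\mathrm{opp}}$); HS-maps $(E,\Phi)\to(F,\Psi)$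 are the $A$-linear maps $f:E\to F$ with $f\circ\Phi^p_\Delta(D)_\alpha=\Psi^p_\Delta(D)_\alpha\circ f$ for all $p$, $\Delta$, $D$ and all $\alpha\in\Delta$. A left (resp. right) integrable connection over $A/k$ on $E$ is a left $A$-linear map $\nabla:\mathrm{Der}_k(A)\to R$, with $R=\mathrm{End}_k(E)$ (resp. $R=\mathrm{End}_k(E)^{\mathrm{opp}}$), such that $\nabla(\delta)a=a\nabla(\delta)+\delta(a)1_R$ and $\nabla([\delta,\delta'])=[\nabla(\delta),\nabla(\delta')]$ for all $\delta,\delta'\in\mathrm{Der}_k(A)$, $a\in A$; morphisms of $A$-modules with such a connection are the $A$-linear maps that commute with the operators $\nabla(\delta)$. We say that $\nabla$ underlies $\Psi$ if $\Psi^1_{\{0,1\}}(\mathrm{Id}+\delta s)=1+\nabla(\delta)s$ for all $\delta\in\mathrm{Der}_k(A)$. Statement. The category of left (resp. right) HS-modules over $A/k$ coincides with the category of $A$-modules endowed with a left (resp. right) integrable connection over $A/k$: there is an isomorphism of categories from the former to the latter which is the identity on underlying $A$-modules and on underlying $A$-linear maps, and which sends $(E,\Psi)$ to $(E,\nabla)$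 where $\nabla$ underlies $\Psi$. Moreover every left (resp. right) integrable connection on an $A$-module $E$ underlies a unique left (resp. right) HS-module structure on $E$. -/

import Mathlib

universe u v w

open Finset.HasAntidiagonal (antidiagonal mem_antidiagonal)

namespace HSMod

/-! ### Co-ideals and truncated power series -/

/-- Non-empty co-ideals of `ℕ^p`: non-empty subsets closed under passing to smaller multi-indices. -/
structure Coideal (p : ℕ) where
  carrier : Set (Fin p →₀ ℕ)
  nonempty : carrier.Nonempty
  lower : ∀ {α β : Fin p →₀ ℕ}, α ∈ carrier → β ≤ α → β ∈ carrier

instance (p : ℕ) : Membership (Fin p →₀ ℕ) (Coideal p) := ⟨fun Δ α => α ∈ Δ.carrier⟩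

theorem Coideal.mem_of_le {p : ℕ} {Δ : Coideal p} {α β : Fin p →₀ ℕ} (h : α ∈ Δ) (hβ : β ≤ α) :
    β ∈ Δ := Δ.lower h hβ

theorem Coideal.zero_mem {p : ℕ} (Δ : Coideal p) : (0 : Fin p →₀ ℕ) ∈ Δ := by
  obtain ⟨α, hα⟩ := Δ.nonempty
  exact Δ.lower hα zero_le

/-- The co-ideal `{α' | α' ≤ α}`. -/
def Coideal.below {p : ℕ} (α : Fin p →₀ ℕ) : Coideal p where
  carrier := Set.Iic α
  nonempty := ⟨α, le_refl α⟩
  lower := fun h h' => le_trans h' h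

/-- The co-ideal `{0, 1}` of `ℕ = ℕ^1`. -/
noncomputable def Coideal.one : Coideal 1 := Coideal.below (Finsupp.single 0 1)

theorem fst_le_of_mem {p : ℕ} {α : Fin p →₀ ℕ} {c : (Fin p →₀ ℕ) × (Fin p →₀ ℕ)}
    (hc : c ∈ antidiagonal α) : c.1 ≤ α := by
  rw [← mem_antidiagonal.mp hc]
  exact le_self_add

theorem snd_le_of_mem {p : ℕ} {α : Fin p →₀ ℕ} {c : (Fin p →₀ ℕ) × (Fin p →₀ ℕ)}
    (hc : c ∈ antidiagonal α) : c.2 ≤ α := by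
  rw [← mem_antidiagonal.mp hc]
  exact le_add_self

section TPS

variable {p : ℕ}

/-- The ideal `Δ_R` of `R[[s]]`: the series whose coefficients vanish on `Δ`. -/
noncomputable def truncIdeal (R : Type u) [Ring R] (Δ : Coideal p) : Ideal (MvPowerSeries (Fin p) R) where
  carrier := {f | ∀ α ∈ Δ, MvPowerSeries.coeff α f = 0}
  add_mem' := by
    intro f g hf hg α hα
    rw [map_add, hf α hα, hg α hα, add_zero]
  zero_mem' := fun α _ => map_zero _
  smul_mem' := by
    intro c f hf α hα
    rw [smul_eq_mul, MvPowerSeries.coeff_mul]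
    refine Finset.sum_eq_zero fun x hx => ?_
    rw [hf x.2 (Coideal.mem_of_le hα (snd_le_of_mem hx)), mul_zero]

instance (R : Type u) [Ring R] (Δ : Coideal p) : (truncIdeal R Δ).IsTwoSided where
  mul_mem_of_left := by
    intro f g hf α hα
    rw [MvPowerSeries.coeff_mul]
    refine Finset.sum_eq_zero fun x hx => ?_
    rw [hf x.1 (Coideal.mem_of_le hα (fst_le_of_mem hx)), zero_mul]

/-- The ring of truncated power series `R[[s]]_Δ = R[[s]] / Δ_R`, for a not necessarily
commutative ring `R`. -/
abbrev TPS (R : Type u) [Ring R] (Δ : Coideal p) : Type u :=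
  MvPowerSeries (Fin p) R ⧸ truncIdeal R Δ

namespace TPS

variable {R : Type u} [Ring R] {Δ : Coideal p}

/-- The class in `R[[s]]_Δ` of the series `∑ r_α s^α`. -/
noncomputable def mk (Δ : Coideal p) (r : (Fin p →₀ ℕ) → R) : TPS R Δ :=
  Ideal.Quotient.mk (truncIdeal R Δ) r

open Classical in
/-- The coefficient of `s^α`, with the convention that it is `0` for `α ∉ Δ`. -/
noncomputable def coeff (α : Fin p →₀ ℕ) (x : TPS R Δ) : R :=
  if α ∈ Δ then MvPowerSeries.coeff α (Quotient.out x : MvPowerSeries (Fin p) R) else 0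

/-- The class of the monomial `r s^α`. -/
noncomputable def monomial (Δ : Coideal p) (α : Fin p →₀ ℕ) (r : R) : TPS R Δ :=
  Ideal.Quotient.mk (truncIdeal R Δ) (MvPowerSeries.monomial α r)

theorem coeff_mk' {α : Fin p →₀ ℕ} (hα : α ∈ Δ) (f : MvPowerSeries (Fin p) R) :
    coeff α (Ideal.Quotient.mk (truncIdeal R Δ) f) = MvPowerSeries.coeff α f := by
  rw [coeff, if_pos hα]
  have h : Ideal.Quotient.mk (truncIdeal R Δ)
      (Quotient.out (Ideal.Quotient.mk (truncIdeal R Δ) f)) =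
      Ideal.Quotient.mk (truncIdeal R Δ) f := Quotient.out_eq _
  rw [Ideal.Quotient.eq] at h
  have := h α hα
  rwa [map_sub, sub_eq_zero] at this

theorem coeff_mk {α : Fin p →₀ ℕ} (hα : α ∈ Δ) (r : (Fin p →₀ ℕ) → R) :
    coeff α (mk Δ r) = r α := coeff_mk' hα _

theorem coeff_of_notMem {α : Fin p →₀ ℕ} (hα : α ∉ Δ) (x : TPS R Δ) : coeff α x = 0 := by
  rw [coeff, if_neg hα]

theorem ext {x y : TPS R Δ} (h : ∀ α ∈ Δ, coeff α x = coeff α y) : x = y := by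
  obtain ⟨f, rfl⟩ := Ideal.Quotient.mk_surjective x
  obtain ⟨g, rfl⟩ := Ideal.Quotient.mk_surjective y
  rw [Ideal.Quotient.eq]
  intro α hα
  have := h α hα
  rw [coeff_mk' hα, coeff_mk' hα] at this
  rw [map_sub, this, sub_self]

theorem coeff_add (α : Fin p →₀ ℕ) (x y : TPS R Δ) :
    coeff α (x + y) = coeff α x + coeff α y := by
  by_cases hα : α ∈ Δ
  · obtain ⟨f, rfl⟩ := Ideal.Quotient.mk_surjective x
    obtain ⟨g, rfl⟩ := Ideal.Quotient.mk_surjective y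
    rw [← map_add, coeff_mk' hα, coeff_mk' hα, coeff_mk' hα, map_add]
  · simp only [coeff_of_notMem hα, add_zero]

/-- The coefficient of `s^α` as an additive map. -/
noncomputable def coeffHom (Δ : Coideal p) (α : Fin p →₀ ℕ) : TPS R Δ →+ R :=
  AddMonoidHom.mk' (coeff α) (coeff_add α)

theorem coeff_zero (α : Fin p →₀ ℕ) : coeff α (0 : TPS R Δ) = 0 := map_zero (coeffHom Δ α)

theorem coeff_sum {ι : Type*} (s : Finset ι) (f : ι → TPS R Δ) (α : Fin p →₀ ℕ) :
    coeff α (∑ i ∈ s, f i) = ∑ i ∈ s, coeff α (f i) := map_sum (coeffHom Δ α) f s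

theorem coeff_sub (α : Fin p →₀ ℕ) (x y : TPS R Δ) :
    coeff α (x - y) = coeff α x - coeff α y := map_sub (coeffHom Δ α) x y

theorem coeff_one {α : Fin p →₀ ℕ} (hα : α ∈ Δ) :
    coeff α (1 : TPS R Δ) = if α = 0 then 1 else 0 := by
  rw [← map_one (Ideal.Quotient.mk (truncIdeal R Δ)), coeff_mk' hα, MvPowerSeries.coeff_one]

theorem coeff_mul {α : Fin p →₀ ℕ} (hα : α ∈ Δ) (x y : TPS R Δ) :
    coeff α (x * y) = ∑ c ∈ antidiagonal α, coeff c.1 x * coeff c.2 y := by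
  obtain ⟨f, rfl⟩ := Ideal.Quotient.mk_surjective x
  obtain ⟨g, rfl⟩ := Ideal.Quotient.mk_surjective y
  rw [← map_mul, coeff_mk' hα, MvPowerSeries.coeff_mul]
  refine Finset.sum_congr rfl fun c hc => ?_
  rw [coeff_mk' (Coideal.mem_of_le hα (fst_le_of_mem hc)),
    coeff_mk' (Coideal.mem_of_le hα (snd_le_of_mem hc))]

theorem coeff_zero_one : coeff 0 (1 : TPS R Δ) = 1 := by
  rw [coeff_one Δ.zero_mem, if_pos rfl]

theorem coeff_zero_mul (x y : TPS R Δ) : coeff 0 (x * y) = coeff 0 x * coeff 0 y := by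
  rw [coeff_mul Δ.zero_mem]; simp

theorem coeff_monomial {α : Fin p →₀ ℕ} (hα : α ∈ Δ) (β : Fin p →₀ ℕ) (r : R) :
    coeff α (monomial Δ β r) = if α = β then r else 0 := by
  rw [monomial, coeff_mk' hα, MvPowerSeries.coeff_monomial]

/-- A series whose `0`-degree coefficient is `1` is a unit. -/
theorem isUnit_of_coeff_zero {x : TPS R Δ} (hx : coeff 0 x = 1) : IsUnit x := by
  obtain ⟨f, rfl⟩ := Ideal.Quotient.mk_surjective x
  refine IsUnit.map (Ideal.Quotient.mk (truncIdeal R Δ)) ?_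
  rw [MvPowerSeries.isUnit_iff_constantCoeff]
  rw [coeff_mk' Δ.zero_mem, MvPowerSeries.coeff_zero_eq_constantCoeff_apply] at hx
  rw [hx]
  exact isUnit_one

end TPS

/-- The group `U^p(R; Δ)` of units of `R[[s]]_Δ` whose `0`-degree coefficient is `1`. -/
noncomputable def U (R : Type u) [Ring R] (Δ : Coideal p) : Subgroup (TPS R Δ)ˣ where
  carrier := {r | TPS.coeff 0 (r : TPS R Δ) = 1}
  one_mem' := by
    rw [Set.mem_ofPred_eq, Units.val_one, TPS.coeff_zero_one]
  mul_mem' := by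
    intro r r' h h'
    rw [Set.mem_ofPred_eq] at *
    rw [Units.val_mul, TPS.coeff_zero_mul, h, h', one_mul]
  inv_mem' := by
    intro r h
    rw [Set.mem_ofPred_eq] at *
    have := TPS.coeff_zero_mul (r : TPS R Δ) ((r⁻¹ : (TPS R Δ)ˣ) : TPS R Δ)
    rwa [Units.mul_inv, h, one_mul, TPS.coeff_zero_one, eq_comm] at this

end TPS

/-! ### Hasse--Schmidt derivations -/

section HS

variable (k : Type u) {A : Type v} [CommRing k] [CommRing A] [Algebra k A]
variable {p : ℕ}

/-- The conditions that make a series `D = ∑ D_α s^α` in `End_k(A)[[s]]_Δ` a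
`(p, Δ)`-variate Hasse--Schmidt derivation of `A` over `k`. -/
structure IsHS {Δ : Coideal p} (D : TPS (Module.End k A) Δ) : Prop where
  coeff_zero : TPS.coeff 0 D = 1
  coeff_mul : ∀ α ∈ Δ, ∀ x y : A, TPS.coeff α D (x * y) =
    ∑ c ∈ antidiagonal α, TPS.coeff c.1 D x * TPS.coeff c.2 D y

variable {k} {Δ : Coideal p}

/-- The map `A[[s]]_Δ → A[[s]]_Δ` induced by a series in `End_k(A)[[s]]_Δ`. -/
noncomputable def tilde (r : TPS (Module.End k A) Δ) (x : TPS A Δ) : TPS A Δ :=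
  TPS.mk Δ fun α => ∑ c ∈ antidiagonal α, TPS.coeff c.1 r (TPS.coeff c.2 x)

theorem coeff_tilde {α : Fin p →₀ ℕ} (hα : α ∈ Δ) (r : TPS (Module.End k A) Δ) (x : TPS A Δ) :
    TPS.coeff α (tilde r x) = ∑ c ∈ antidiagonal α, TPS.coeff c.1 r (TPS.coeff c.2 x) :=
  TPS.coeff_mk hα _

theorem tilde_mul (r r' : TPS (Module.End k A) Δ) (x : TPS A Δ) :
    tilde (r * r') x = tilde r (tilde r' x) := by
  refine TPS.ext fun α hα => ?_
  rw [coeff_tilde hα, coeff_tilde hα]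
  have h1 : ∀ c ∈ antidiagonal α, TPS.coeff c.1 (r * r') (TPS.coeff c.2 x) =
      ∑ d ∈ antidiagonal c.1, TPS.coeff d.1 r (TPS.coeff d.2 r' (TPS.coeff c.2 x)) := by
    intro c hc
    rw [TPS.coeff_mul (Coideal.mem_of_le hα (fst_le_of_mem hc))]
    simp [LinearMap.sum_apply]
  have h2 : ∀ c ∈ antidiagonal α, TPS.coeff c.1 r (TPS.coeff c.2 (tilde r' x)) =
      ∑ d ∈ antidiagonal c.2, TPS.coeff c.1 r (TPS.coeff d.1 r' (TPS.coeff d.2 x)) := by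
    intro c hc
    rw [coeff_tilde (Coideal.mem_of_le hα (snd_le_of_mem hc)), map_sum]
  rw [Finset.sum_congr rfl h1, Finset.sum_congr rfl h2, Finset.sum_sigma', Finset.sum_sigma']
  apply Finset.sum_nbij' (fun ⟨⟨_i, j⟩, ⟨k, l⟩⟩ ↦ ⟨(k, l + j), (l, j)⟩)
    (fun ⟨⟨i, _j⟩, ⟨k, l⟩⟩ ↦ ⟨(i + k, l), (i, k)⟩) <;>
  · simp only [Finset.mem_sigma, mem_antidiagonal]
    rintro ⟨⟨a, b⟩, ⟨c, d⟩⟩ ⟨h, h'⟩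
    dsimp only at h h'
    subst h' h
    simp [add_assoc]

theorem tilde_one (x : TPS A Δ) : tilde (1 : TPS (Module.End k A) Δ) x = x := by
  refine TPS.ext fun α hα => ?_
  rw [coeff_tilde hα, Finset.sum_eq_single (0, α)]
  · rw [TPS.coeff_zero_one]; rfl
  · rintro ⟨a, b⟩ hc hne
    have ha : a ≠ 0 := by
      rintro rfl
      apply hne
      rw [mem_antidiagonal, zero_add] at hc
      dsimp only at hc
      rw [hc]
    rw [TPS.coeff_one (Coideal.mem_of_le hα (fst_le_of_mem hc)), if_neg ha]
    rfl
  · intro h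
    exact absurd (by simp) h

/-- The constant series. -/
noncomputable def const (Δ : Coideal p) (x : A) : TPS A Δ := TPS.monomial Δ 0 x

theorem coeff_tilde_const {α : Fin p →₀ ℕ} (hα : α ∈ Δ) (r : TPS (Module.End k A) Δ) (x : A) :
    TPS.coeff α (tilde r (const Δ x)) = TPS.coeff α r x := by
  rw [coeff_tilde hα, Finset.sum_eq_single (α, 0)]
  · rw [const, TPS.coeff_monomial Δ.zero_mem, if_pos rfl]
  · rintro ⟨a, b⟩ hc hne
    have hb : b ≠ 0 := by
      rintro rfl
      apply hne
      rw [mem_antidiagonal, add_zero] at hc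
      dsimp only at hc
      rw [hc]
    rw [const, TPS.coeff_monomial (Coideal.mem_of_le hα (snd_le_of_mem hc)), if_neg hb,
      map_zero]
  · intro h
    exact absurd (by simp) h

theorem const_mul (x y : A) : const Δ (x * y) = const Δ x * const Δ y := by
  rw [const, const, const, TPS.monomial, TPS.monomial, TPS.monomial, ← map_mul,
    MvPowerSeries.monomial_mul_monomial, add_zero]

theorem sum_antidiagonal_comm4 {M : Type*} [AddCommMonoid M] (n : Fin p →₀ ℕ)
    (F : (Fin p →₀ ℕ) → (Fin p →₀ ℕ) → (Fin p →₀ ℕ) → (Fin p →₀ ℕ) → M) :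
    ∑ c ∈ antidiagonal n, ∑ d ∈ antidiagonal c.1, ∑ e ∈ antidiagonal c.2, F d.1 d.2 e.1 e.2 =
    ∑ c ∈ antidiagonal n, ∑ d ∈ antidiagonal c.1, ∑ e ∈ antidiagonal c.2, F d.1 e.1 d.2 e.2 := by
  simp only [← Finset.sum_product', Finset.sum_sigma']
  apply Finset.sum_nbij'
    (fun x ↦ ⟨(x.2.1.1 + x.2.2.1, x.2.1.2 + x.2.2.2),
      ((x.2.1.1, x.2.2.1), (x.2.1.2, x.2.2.2))⟩)
    (fun x ↦ ⟨(x.2.1.1 + x.2.2.1, x.2.1.2 + x.2.2.2),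
      ((x.2.1.1, x.2.2.1), (x.2.1.2, x.2.2.2))⟩) <;>
  · simp only [Finset.mem_sigma, Finset.mem_product, mem_antidiagonal]
    rintro ⟨⟨a, b⟩, ⟨⟨c, d⟩, ⟨e, f⟩⟩⟩ ⟨h, h', h''⟩
    dsimp only at h h' h''
    subst h' h'' h
    simp [add_add_add_comm]

theorem IsHS.tilde_mul {D : TPS (Module.End k A) Δ} (hD : IsHS k D) (x y : TPS A Δ) :
    tilde D (x * y) = tilde D x * tilde D y := by
  refine TPS.ext fun α hα => ?_
  rw [coeff_tilde hα, TPS.coeff_mul hα]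
  have h1 : ∀ c ∈ antidiagonal α, TPS.coeff c.1 D (TPS.coeff c.2 (x * y)) =
      ∑ d ∈ antidiagonal c.1, ∑ e ∈ antidiagonal c.2,
        (TPS.coeff d.1 D (TPS.coeff e.1 x)) * (TPS.coeff d.2 D (TPS.coeff e.2 y)) := by
    intro c hc
    rw [TPS.coeff_mul (Coideal.mem_of_le hα (snd_le_of_mem hc)), map_sum, Finset.sum_comm]
    refine Finset.sum_congr rfl fun e _ => ?_
    exact hD.coeff_mul _ (Coideal.mem_of_le hα (fst_le_of_mem hc)) _ _
  have h2 : ∀ c ∈ antidiagonal α, TPS.coeff c.1 (tilde D x) * TPS.coeff c.2 (tilde D y) =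
      ∑ d ∈ antidiagonal c.1, ∑ e ∈ antidiagonal c.2,
        (TPS.coeff d.1 D (TPS.coeff d.2 x)) * (TPS.coeff e.1 D (TPS.coeff e.2 y)) := by
    intro c hc
    rw [coeff_tilde (Coideal.mem_of_le hα (fst_le_of_mem hc)),
      coeff_tilde (Coideal.mem_of_le hα (snd_le_of_mem hc)), Finset.sum_mul_sum]
  rw [Finset.sum_congr rfl h1, Finset.sum_congr rfl h2]
  exact sum_antidiagonal_comm4 α fun a b c d =>
    (TPS.coeff a D (TPS.coeff c x)) * (TPS.coeff b D (TPS.coeff d y))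

theorem isHS_iff (D : TPS (Module.End k A) Δ) : IsHS k D ↔ TPS.coeff 0 D = 1 ∧
    ∀ x y : A, tilde D (const Δ (x * y)) = tilde D (const Δ x) * tilde D (const Δ y) := by
  constructor
  · intro h
    refine ⟨h.coeff_zero, fun x y => ?_⟩
    rw [const_mul, h.tilde_mul]
  · rintro ⟨h0, h⟩
    refine ⟨h0, fun α hα x y => ?_⟩
    rw [← coeff_tilde_const hα, h, TPS.coeff_mul hα]
    refine Finset.sum_congr rfl fun c hc => ?_
    rw [coeff_tilde_const (Coideal.mem_of_le hα (fst_le_of_mem hc)),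
      coeff_tilde_const (Coideal.mem_of_le hα (snd_le_of_mem hc))]

variable (k A) in
/-- The group `HS^p_k(A; Δ)` of `(p, Δ)`-variate Hasse--Schmidt derivations of `A` over `k`,
as a subgroup of the units of `End_k(A)[[s]]_Δ`. -/
noncomputable def HS (Δ : Coideal p) : Subgroup (TPS (Module.End k A) Δ)ˣ where
  carrier := {D | IsHS k (D : TPS (Module.End k A) Δ)}
  one_mem' := by
    rw [Set.mem_ofPred_eq, Units.val_one, isHS_iff]
    refine ⟨TPS.coeff_zero_one, fun x y => ?_⟩
    rw [tilde_one, tilde_one, tilde_one, const_mul]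
  mul_mem' := by
    intro D E hD hE
    rw [Set.mem_ofPred_eq] at *
    rw [Units.val_mul, isHS_iff]
    refine ⟨?_, fun x y => ?_⟩
    · rw [TPS.coeff_zero_mul, hD.coeff_zero, hE.coeff_zero, one_mul]
    · rw [tilde_mul, tilde_mul, tilde_mul, const_mul, hE.tilde_mul, hD.tilde_mul]
  inv_mem' := by
    intro D hD
    have hU : D⁻¹ ∈ U (Module.End k A) Δ := (U (Module.End k A) Δ).inv_mem hD.coeff_zero
    rw [Set.mem_ofPred_eq] at *
    rw [isHS_iff]
    refine ⟨hU, fun x y => ?_⟩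
    have h1 : ∀ z, tilde (D : TPS (Module.End k A) Δ)
        (tilde ((D⁻¹ : (TPS (Module.End k A) Δ)ˣ) : TPS (Module.End k A) Δ) z) = z := by
      intro z
      rw [← tilde_mul, Units.mul_inv, tilde_one]
    have h2 : ∀ z, tilde ((D⁻¹ : (TPS (Module.End k A) Δ)ˣ) : TPS (Module.End k A) Δ)
        (tilde (D : TPS (Module.End k A) Δ) z) = z := by
      intro z
      rw [← tilde_mul, Units.inv_mul, tilde_one]
    rw [← h2 (tilde _ (const Δ x) * tilde _ (const Δ y)), hD.tilde_mul, h1, h1, const_mul]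

theorem IsHS.isUnit {D : TPS (Module.End k A) Δ} (hD : IsHS k D) : IsUnit D :=
  TPS.isUnit_of_coeff_zero hD.coeff_zero

/-- A series satisfying the Hasse--Schmidt conditions, as an element of the group. -/
noncomputable def IsHS.toHS {D : TPS (Module.End k A) Δ} (hD : IsHS k D) : HS k A Δ :=
  ⟨hD.isUnit.unit, hD⟩

theorem isHS_ofDerivation (δ : Derivation k A A) :
    IsHS k (1 + TPS.monomial Coideal.one (Finsupp.single 0 1) (δ : A →ₗ[k] A) :
      TPS (Module.End k A) Coideal.one) := by
  have h01 : (0 : Fin 1 →₀ ℕ) ≠ Finsupp.single 0 1 := by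
    intro h
    have := DFunLike.congr_fun h 0
    simp at this
  have hmem : Finsupp.single (0 : Fin 1) 1 ∈ Coideal.one := le_refl (Finsupp.single (0 : Fin 1) 1)
  have c0 : TPS.coeff 0 (1 + TPS.monomial Coideal.one (Finsupp.single 0 1) (δ : A →ₗ[k] A) :
      TPS (Module.End k A) Coideal.one) = 1 := by
    rw [TPS.coeff_add, TPS.coeff_zero_one, TPS.coeff_monomial (Coideal.zero_mem _), if_neg h01,
      add_zero]
  have c1 : TPS.coeff (Finsupp.single 0 1)
      (1 + TPS.monomial Coideal.one (Finsupp.single 0 1) (δ : A →ₗ[k] A) :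
      TPS (Module.End k A) Coideal.one) = (δ : A →ₗ[k] A) := by
    rw [TPS.coeff_add, TPS.coeff_one hmem, if_neg h01.symm, TPS.coeff_monomial hmem, if_pos rfl,
      zero_add]
  refine ⟨c0, fun α hα x y => ?_⟩
  have hα' : α = 0 ∨ α = Finsupp.single 0 1 := by
    have h : α 0 ≤ 1 := by simpa using (show α ≤ Finsupp.single 0 1 from hα) 0
    rcases Nat.le_one_iff_eq_zero_or_eq_one.mp h with h | h
    · left; ext; simpa using h
    · right; ext; simpa using h
  rcases hα' with rfl | rfl
  · simp [c0]
  · rw [c1, Finsupp.antidiagonal_single]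
    simp [c0, c1, Finset.Nat.antidiagonal_succ, mul_comm]

/-- The Hasse--Schmidt derivation `Id + δ s` in `HS^1_k(A; {0, 1})`. -/
noncomputable def HS.ofDerivation (δ : Derivation k A A) : HS k A Coideal.one :=
  (isHS_ofDerivation δ).toHS

end HS

/-! ### Substitution maps -/

section Subst

variable {A : Type v} [CommRing A] {p q : ℕ}

namespace TPS

/-- The variable `s_i` in `R[[s]]_Δ`. -/
noncomputable def X {R : Type u} [Ring R] (Δ : Coideal p) (i : Fin p) : TPS R Δ :=
  monomial Δ (Finsupp.single i 1) 1

theorem coeff_smul {Δ : Coideal p} (α : Fin p →₀ ℕ) (a : A) (x : TPS A Δ) :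
    coeff α (a • x) = a * coeff α x := by
  by_cases hα : α ∈ Δ
  · obtain ⟨f, rfl⟩ := Ideal.Quotient.mk_surjective x
    have : a • Ideal.Quotient.mk (truncIdeal A Δ) f = Ideal.Quotient.mk (truncIdeal A Δ) (a • f) :=
      rfl
    rw [this, coeff_mk' hα, coeff_mk' hα, MvPowerSeries.coeff_smul]
  · rw [coeff_of_notMem hα, coeff_of_notMem hα, mul_zero]

theorem monomial_eq_smul {Δ : Coideal p} (α : Fin p →₀ ℕ) (a : A) :
    monomial Δ α a = a • monomial Δ α (1 : A) := by
  refine ext fun β hβ => ?_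
  rw [coeff_smul, coeff_monomial hβ, coeff_monomial hβ]
  split_ifs <;> simp

end TPS

/-- Substitution maps `A[[s]]_Δ → A[[t]]_Ω`: the `A`-algebra maps `φ` such that every `φ(s_i)`
has order at least `1`, i.e. has no term of degree `0`. -/
structure SubstMap (A : Type v) [CommRing A] (Δ : Coideal p) (Ω : Coideal q) where
  toAlgHom : TPS A Δ →ₐ[A] TPS A Ω
  order_X : ∀ i : Fin p, TPS.coeff 0 (toAlgHom (TPS.X Δ i)) = 0

variable {Δ : Coideal p} {Ω : Coideal q}

/-- The finite set of multi-indices of degree at most `n`. -/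
noncomputable def degLE (p n : ℕ) : Finset (Fin p →₀ ℕ) :=
  (Finsupp.finite_of_degree_le (σ := Fin p) n).toFinset

theorem mem_degLE {n : ℕ} {α : Fin p →₀ ℕ} : α ∈ degLE p n ↔ α.degree ≤ n := by
  simp [degLE]

theorem exists_sum_X_mul (f : MvPowerSeries (Fin p) A) (n : ℕ)
    (hf : ∀ α : Fin p →₀ ℕ, α.degree < n + 1 → MvPowerSeries.coeff α f = 0) :
    ∃ g : Fin p → MvPowerSeries (Fin p) A,
      f = ∑ i, MvPowerSeries.monomial (Finsupp.single i 1) 1 * g i ∧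
      ∀ i, ∀ α : Fin p →₀ ℕ, α.degree < n → MvPowerSeries.coeff α (g i) = 0 := by
  classical
  let P : (Fin p →₀ ℕ) → Fin p → Prop := fun α i => α i ≠ 0 ∧ ∀ j < i, α j = 0
  let g : Fin p → MvPowerSeries (Fin p) A := fun i β =>
    if P (β + Finsupp.single i 1) i then MvPowerSeries.coeff (β + Finsupp.single i 1) f else 0
  have hg : ∀ i β, MvPowerSeries.coeff β (g i) = if P (β + Finsupp.single i 1) i then
      MvPowerSeries.coeff (β + Finsupp.single i 1) f else 0 := fun _ _ => rfl
  refine ⟨g, ?_, ?_⟩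
  · ext α
    rw [map_sum]
    have key : ∀ i, MvPowerSeries.coeff α
        (MvPowerSeries.monomial (Finsupp.single i 1) 1 * g i) =
        if P α i then MvPowerSeries.coeff α f else 0 := by
      intro i
      rw [MvPowerSeries.coeff_monomial_mul]
      by_cases h : Finsupp.single i 1 ≤ α
      · rw [if_pos h, one_mul, hg, tsub_add_cancel_of_le h]
      · rw [if_neg h, if_neg]
        rintro ⟨hi, -⟩
        apply h
        rw [Finsupp.single_le_iff]
        omega
    rw [Finset.sum_congr rfl fun i _ => key i]
    by_cases h0 : α = 0
    · subst h0
      rw [hf 0 (by simp)]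
      simp
    · have hne : α.support.Nonempty := Finsupp.support_nonempty_iff.mpr h0
      have hP : P α (α.support.min' hne) := by
        refine ⟨Finsupp.mem_support_iff.mp (Finset.min'_mem _ hne), fun j hj => ?_⟩
        by_contra hj'
        exact absurd (Finset.min'_le _ j (Finsupp.mem_support_iff.mpr hj')) (not_le.mpr hj)
      rw [Finset.sum_eq_single (α.support.min' hne), if_pos hP]
      · intro i _ hi
        rw [if_neg]
        intro hPi
        rcases lt_trichotomy i (α.support.min' hne) with h | h | h
        · exact hPi.1 (hP.2 _ h)
        · exact hi h
        · exact hP.1 (hPi.2 _ h)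
      · intro h
        exact absurd (Finset.mem_univ _) h
  · intro i α hα
    rw [hg, hf _ (by rw [map_add, Finsupp.degree_single]; omega), ite_self]

namespace SubstMap

theorem coeff_eq_zero (φ : SubstMap A Δ Ω) (n : ℕ) : ∀ f : MvPowerSeries (Fin p) A,
    (∀ α : Fin p →₀ ℕ, α.degree < n → MvPowerSeries.coeff α f = 0) →
    ∀ e ∈ Ω, e.degree < n →
      TPS.coeff e (φ.toAlgHom (Ideal.Quotient.mk (truncIdeal A Δ) f)) = 0 := by
  induction n with
  | zero => intro f _ e _ he; omega
  | succ n ih =>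
    intro f hf e he hen
    obtain ⟨g, rfl, hg⟩ := exists_sum_X_mul f n hf
    rw [map_sum, map_sum, TPS.coeff_sum]
    refine Finset.sum_eq_zero fun i _ => ?_
    rw [map_mul, map_mul, TPS.coeff_mul he]
    refine Finset.sum_eq_zero fun c hc => ?_
    by_cases h0 : c.1 = 0
    · have := φ.order_X i
      rw [TPS.X, TPS.monomial] at this
      rw [h0, this, zero_mul]
    · rw [ih (g i) (hg i) c.2 (Coideal.mem_of_le he (snd_le_of_mem hc)), mul_zero]
      have h1 : c.1.degree ≠ 0 := fun h => h0 ((Finsupp.degree_eq_zero_iff _).mp h)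
      have h2 := congrArg Finsupp.degree (mem_antidiagonal.mp hc)
      rw [map_add] at h2
      omega

theorem coeff_monomial_eq_zero (φ : SubstMap A Δ Ω) {α : Fin p →₀ ℕ} {e : Fin q →₀ ℕ}
    (he : e ∈ Ω) (h : e.degree < α.degree) :
    TPS.coeff e (φ.toAlgHom (TPS.monomial Δ α 1)) = 0 := by
  classical
  refine φ.coeff_eq_zero α.degree _ (fun β hβ => ?_) e he h
  rw [MvPowerSeries.coeff_monomial, if_neg]
  rintro rfl
  omega

theorem coeff_apply (φ : SubstMap A Δ Ω) {e : Fin q →₀ ℕ} (he : e ∈ Ω) (x : TPS A Δ) :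
    TPS.coeff e (φ.toAlgHom x) = ∑ α ∈ degLE p e.degree,
      TPS.coeff e (φ.toAlgHom (TPS.monomial Δ α 1)) * TPS.coeff α x := by
  classical
  let f : MvPowerSeries (Fin p) A := fun α => TPS.coeff α x
  have hf : ∀ α, MvPowerSeries.coeff α f = TPS.coeff α x := fun _ => rfl
  let g : MvPowerSeries (Fin p) A :=
    ∑ α ∈ degLE p e.degree, MvPowerSeries.monomial α (TPS.coeff α x)
  have hx : x = Ideal.Quotient.mk (truncIdeal A Δ) f :=
    TPS.ext fun α hα => by rw [TPS.coeff_mk' hα, hf]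
  have hfg : TPS.coeff e (φ.toAlgHom (Ideal.Quotient.mk (truncIdeal A Δ) (f - g))) = 0 := by
    refine φ.coeff_eq_zero (e.degree + 1) _ (fun β hβ => ?_) e he (Nat.lt_succ_self _)
    rw [map_sub, hf, map_sum, Finset.sum_eq_single β, MvPowerSeries.coeff_monomial_same, sub_self]
    · intro α _ hne
      rw [MvPowerSeries.coeff_monomial_ne hne.symm]
    · intro h
      exact absurd (mem_degLE.mpr (Nat.lt_succ_iff.mp hβ)) h
  rw [map_sub, map_sub, TPS.coeff_sub, ← hx, sub_eq_zero] at hfg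
  rw [hfg, map_sum, map_sum, TPS.coeff_sum]
  refine Finset.sum_congr rfl fun α _ => ?_
  have := TPS.monomial_eq_smul (Δ := Δ) α (TPS.coeff α x)
  rw [TPS.monomial] at this
  rw [this, map_smul, TPS.coeff_smul, mul_comm]

end SubstMap

/-- The action `φ • r = ∑_α φ(s^α) r_α` of a substitution map on a series with coefficients in an
algebra `ι : A → R` over `A`. Each coefficient of this series is a finite sum, since `φ(s^α)`
has order at least `|α|`. -/
noncomputable def bullet {R : Type w} [Ring R] (ι : A →+* R) (φ : SubstMap A Δ Ω) (r : TPS R Δ) :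
    TPS R Ω :=
  TPS.mk Ω fun e => ∑ᶠ α : Fin p →₀ ℕ,
    ι (TPS.coeff e (φ.toAlgHom (TPS.monomial Δ α 1))) * TPS.coeff α r

theorem coeff_bullet {R : Type w} [Ring R] (ι : A →+* R) (φ : SubstMap A Δ Ω) (r : TPS R Δ)
    {e : Fin q →₀ ℕ} (he : e ∈ Ω) :
    TPS.coeff e (bullet ι φ r) = ∑ α ∈ degLE p e.degree,
      ι (TPS.coeff e (φ.toAlgHom (TPS.monomial Δ α 1))) * TPS.coeff α r := by
  rw [bullet, TPS.coeff_mk he]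
  refine finsum_eq_sum_of_support_subset _ fun α hα => ?_
  rw [Finset.mem_coe, mem_degLE]
  by_contra h
  apply hα
  dsimp only
  rw [φ.coeff_monomial_eq_zero he (not_le.mp h), map_zero, zero_mul]

end Subst

section Act

variable (k : Type u) (A : Type v) [CommRing k] [CommRing A] [Algebra k A]
variable (E : Type w) [AddCommGroup E] [Module k E] [Module A E] [IsScalarTower k A E]

/-- The structure of `k`-algebra over `A` on `End_k(E)`. -/
def leftAct : A →ₐ[k] Module.End k E := Algebra.lsmul k k E

/-- The structure of `k`-algebra over `A` on `End_k(E)^opp`. -/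
def rightAct : A →ₐ[k] (Module.End k E)ᵐᵒᵖ :=
  (Algebra.lsmul k k E).toOpposite fun a b => by
    rw [Commute, SemiconjBy, ← map_mul, ← map_mul, mul_comm]

end Act

section HSAction

variable {k : Type u} {A : Type v} [CommRing k] [CommRing A] [Algebra k A] {p q : ℕ}
  {Δ : Coideal p} {Ω : Coideal q}

theorem isHS_bullet (φ : SubstMap A Δ Ω) {D : TPS (Module.End k A) Δ} (hD : IsHS k D) :
    IsHS k (bullet (leftAct k A A : A →+* Module.End k A) φ D) := by
  have key : ∀ x : A, tilde (bullet (leftAct k A A : A →+* Module.End k A) φ D) (const Ω x) =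
      φ.toAlgHom (tilde D (const Δ x)) := by
    intro x
    refine TPS.ext fun e he => ?_
    rw [coeff_tilde_const he, coeff_bullet _ _ _ he, φ.coeff_apply he, LinearMap.sum_apply]
    refine Finset.sum_congr rfl fun α _ => ?_
    by_cases hα : α ∈ Δ
    · rw [coeff_tilde_const hα]
      rfl
    · rw [TPS.coeff_of_notMem hα, TPS.coeff_of_notMem hα, mul_zero, mul_zero]
      rfl
  rw [isHS_iff]
  refine ⟨?_, fun x y => ?_⟩
  · have h1 : TPS.monomial Δ 0 (1 : A) = 1 := by
      refine TPS.ext fun α hα => ?_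
      rw [TPS.coeff_monomial hα, TPS.coeff_one hα]
    have h2 : degLE p (0 : Fin q →₀ ℕ).degree = {0} := by
      ext α
      rw [mem_degLE, map_zero, Finset.mem_singleton, Nat.le_zero, Finsupp.degree_eq_zero_iff]
    rw [coeff_bullet _ _ _ Ω.zero_mem, h2, Finset.sum_singleton, h1, map_one, TPS.coeff_zero_one,
      hD.coeff_zero, map_one, one_mul]
  · rw [key, key, key, ← map_mul, const_mul, hD.tilde_mul]

/-- The action `φ • D` of a substitution map on a Hasse--Schmidt derivation. -/
noncomputable def SubstMap.act (φ : SubstMap A Δ Ω) (D : HS k A Δ) : HS k A Ω :=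
  (isHS_bullet φ D.2).toHS

end HSAction

/-! ### HS-structures and LR-admissible maps -/

section Structures

variable {k : Type u} {A : Type v} [CommRing k] [CommRing A] [Algebra k A]
variable {R : Type w} [Ring R] [Algebra k R]

/-- A HS-structure over `A/k` on a `k`-algebra `ι : A → R` over `A`. -/
structure HSStructure (ι : A →ₐ[k] R) where
  toHom : ∀ {p : ℕ} (Δ : Coideal p), HS k A Δ →* U R Δ
  leibniz : ∀ {p : ℕ} (Δ : Coideal p) (D : HS k A Δ) (a : A), ∀ α ∈ Δ,
    TPS.coeff α ((toHom Δ D : (TPS R Δ)ˣ) : TPS R Δ) * ι a =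
      ∑ c ∈ antidiagonal α,
        ι (TPS.coeff c.1 ((D : (TPS (Module.End k A) Δ)ˣ) : TPS (Module.End k A) Δ) a) *
          TPS.coeff c.2 ((toHom Δ D : (TPS R Δ)ˣ) : TPS R Δ)
  subst : ∀ {p q : ℕ} {Δ : Coideal p} {Ω : Coideal q} (φ : SubstMap A Δ Ω) (D : HS k A Δ),
    ((toHom Ω (φ.act D) : (TPS R Ω)ˣ) : TPS R Ω) =
      bullet (ι : A →+* R) φ ((toHom Δ D : (TPS R Δ)ˣ) : TPS R Δ)

/-- The coefficient `Ψ^p_Δ(D)_α` of `s^α` in `Ψ^p_Δ(D)`. -/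
noncomputable def HSStructure.comp {ι : A →ₐ[k] R} (Ψ : HSStructure ι) {p : ℕ} {Δ : Coideal p}
    (D : HS k A Δ) (α : Fin p →₀ ℕ) : R :=
  TPS.coeff α ((Ψ.toHom Δ D : (TPS R Δ)ˣ) : TPS R Δ)

/-- An LR-admissible map `∇ : Der_k(A) → R` to a `k`-algebra `ι : A → R` over `A`. -/
structure LRAdmissible (ι : A →ₐ[k] R) where
  toFun : Derivation k A A → R
  map_add : ∀ δ δ', toFun (δ + δ') = toFun δ + toFun δ'
  map_smul : ∀ (a : A) δ, toFun (a • δ) = ι a * toFun δ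
  leibniz : ∀ δ (a : A), toFun δ * ι a = ι a * toFun δ + ι (δ a)
  map_lie : ∀ δ δ', toFun ⁅δ, δ'⁆ = ⁅toFun δ, toFun δ'⁆

/-- The HS-structure `Ψ` has `∇` as underlying LR-admissible map:
`Ψ^1_{0,1}(Id + δ s) = 1 + ∇(δ) s` for all `δ ∈ Der_k(A)`. -/
def HSStructure.HasUnderlying {ι : A →ₐ[k] R} (Ψ : HSStructure ι) (nabla : LRAdmissible ι) :
    Prop :=
  ∀ δ : Derivation k A A,
    ((Ψ.toHom Coideal.one (HS.ofDerivation δ) : (TPS R Coideal.one)ˣ) : TPS R Coideal.one) =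
      1 + TPS.monomial Coideal.one (Finsupp.single 0 1) (nabla.toFun δ)

end Structures

/-! ### The four categories -/

section Categories

variable (k : Type u) (A : Type v) [CommRing k] [CommRing A] [Algebra k A]

/-- A left integrable connection over `A/k` on the `A`-module `E`. -/
abbrev LeftConnection (E : Type w) [AddCommGroup E] [Module k E] [Module A E]
    [IsScalarTower k A E] := LRAdmissible (leftAct k A E)

/-- A right integrable connection over `A/k` on the `A`-module `E`. -/
abbrev RightConnection (E : Type w) [AddCommGroup E] [Module k E] [Module A E]
    [IsScalarTower k A E] := LRAdmissible (rightAct k A E)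

/-- A left HS-module structure over `A/k` on the `A`-module `E`. -/
abbrev LeftHSStructure (E : Type w) [AddCommGroup E] [Module k E] [Module A E]
    [IsScalarTower k A E] := HSStructure (leftAct k A E)

/-- A right HS-module structure over `A/k` on the `A`-module `E`. -/
abbrev RightHSStructure (E : Type w) [AddCommGroup E] [Module k E] [Module A E]
    [IsScalarTower k A E] := HSStructure (rightAct k A E)

/-- Left HS-modules over `A/k`. -/
structure LeftHSModule where
  carrier : Type w
  [addCommGroup : AddCommGroup carrier]
  [moduleBase : Module k carrier]
  [module : Module A carrier]
  [isScalarTower : IsScalarTower k A carrier]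
  hs : LeftHSStructure k A carrier

namespace LeftHSModule

attribute [instance] addCommGroup moduleBase module isScalarTower

variable {k A}

/-- HS-maps between left HS-modules. -/
@[ext]
structure Hom (M N : LeftHSModule.{u, v, w} k A) where
  toLin : M.carrier →ₗ[A] N.carrier
  comm : ∀ {p : ℕ} {Δ : Coideal p} (D : HS k A Δ), ∀ α ∈ Δ, ∀ e : M.carrier,
    toLin ((M.hs.comp D α) e) = (N.hs.comp D α) (toLin e)

instance : CategoryTheory.Category (LeftHSModule.{u, v, w} k A) where
  Hom := Hom
  id M := { toLin := LinearMap.id, comm := by intros; rfl }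
  comp f g :=
    { toLin := g.toLin.comp f.toLin
      comm := by
        intros
        rw [LinearMap.comp_apply, LinearMap.comp_apply, f.comm, g.comm] <;> assumption }

variable (k A)

/-- The forgetful functor to `A`-modules. -/
def forget : CategoryTheory.Functor (LeftHSModule.{u, v, w} k A) (ModuleCat.{w} A) where
  obj M := ModuleCat.of A M.carrier
  map f := ModuleCat.ofHom f.toLin

end LeftHSModule

/-- Right HS-modules over `A/k`. -/
structure RightHSModule where
  carrier : Type w
  [addCommGroup : AddCommGroup carrier]
  [moduleBase : Module k carrier]
  [module : Module A carrier]
  [isScalarTower : IsScalarTower k A carrier]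
  hs : RightHSStructure k A carrier

namespace RightHSModule

attribute [instance] addCommGroup moduleBase module isScalarTower

variable {k A}

/-- HS-maps between right HS-modules. -/
@[ext]
structure Hom (M N : RightHSModule.{u, v, w} k A) where
  toLin : M.carrier →ₗ[A] N.carrier
  comm : ∀ {p : ℕ} {Δ : Coideal p} (D : HS k A Δ), ∀ α ∈ Δ, ∀ e : M.carrier,
    toLin ((MulOpposite.unop (M.hs.comp D α)) e) = (MulOpposite.unop (N.hs.comp D α)) (toLin e)

instance : CategoryTheory.Category (RightHSModule.{u, v, w} k A) where
  Hom := Hom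
  id M := { toLin := LinearMap.id, comm := by intros; rfl }
  comp f g :=
    { toLin := g.toLin.comp f.toLin
      comm := by
        intros
        rw [LinearMap.comp_apply, LinearMap.comp_apply, f.comm, g.comm] <;> assumption }

variable (k A)

/-- The forgetful functor to `A`-modules. -/
def forget : CategoryTheory.Functor (RightHSModule.{u, v, w} k A) (ModuleCat.{w} A) where
  obj M := ModuleCat.of A M.carrier
  map f := ModuleCat.ofHom f.toLin

end RightHSModule

/-- `A`-modules endowed with a left integrable connection over `A/k`. -/
structure LeftConnModule where
  carrier : Type w
  [addCommGroup : AddCommGroup carrier]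
  [moduleBase : Module k carrier]
  [module : Module A carrier]
  [isScalarTower : IsScalarTower k A carrier]
  nabla : LeftConnection k A carrier

namespace LeftConnModule

attribute [instance] addCommGroup moduleBase module isScalarTower

variable {k A}

/-- Horizontal maps: `A`-linear maps commuting with the connections. -/
@[ext]
structure Hom (M N : LeftConnModule.{u, v, w} k A) where
  toLin : M.carrier →ₗ[A] N.carrier
  comm : ∀ (δ : Derivation k A A) (e : M.carrier),
    toLin ((M.nabla.toFun δ) e) = (N.nabla.toFun δ) (toLin e)

instance : CategoryTheory.Category (LeftConnModule.{u, v, w} k A) where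
  Hom := Hom
  id M := { toLin := LinearMap.id, comm := by intros; rfl }
  comp f g :=
    { toLin := g.toLin.comp f.toLin
      comm := by
        intros
        rw [LinearMap.comp_apply, LinearMap.comp_apply, f.comm, g.comm] }

variable (k A)

/-- The forgetful functor to `A`-modules. -/
def forget : CategoryTheory.Functor (LeftConnModule.{u, v, w} k A) (ModuleCat.{w} A) where
  obj M := ModuleCat.of A M.carrier
  map f := ModuleCat.ofHom f.toLin

end LeftConnModule

/-- `A`-modules endowed with a right integrable connection over `A/k`. -/
structure RightConnModule where
  carrier : Type w
  [addCommGroup : AddCommGroup carrier]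
  [moduleBase : Module k carrier]
  [module : Module A carrier]
  [isScalarTower : IsScalarTower k A carrier]
  nabla : RightConnection k A carrier

namespace RightConnModule

attribute [instance] addCommGroup moduleBase module isScalarTower

variable {k A}

/-- Horizontal maps: `A`-linear maps commuting with the connections. -/
@[ext]
structure Hom (M N : RightConnModule.{u, v, w} k A) where
  toLin : M.carrier →ₗ[A] N.carrier
  comm : ∀ (δ : Derivation k A A) (e : M.carrier),
    toLin ((MulOpposite.unop (M.nabla.toFun δ)) e) = (MulOpposite.unop (N.nabla.toFun δ)) (toLin e)

instance : CategoryTheory.Category (RightConnModule.{u, v, w} k A) where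
  Hom := Hom
  id M := { toLin := LinearMap.id, comm := by intros; rfl }
  comp f g :=
    { toLin := g.toLin.comp f.toLin
      comm := by
        intros
        rw [LinearMap.comp_apply, LinearMap.comp_apply, f.comm, g.comm] }

variable (k A)

/-- The forgetful functor to `A`-modules. -/
def forget : CategoryTheory.Functor (RightConnModule.{u, v, w} k A) (ModuleCat.{w} A) where
  obj M := ModuleCat.of A M.carrier
  map f := ModuleCat.ofHom f.toLin

end RightConnModule

end Categories

end HSMod

/-! Let χ be the Euler derivation that multiplies the coefficient of s^α by |α|. A Hasse–Schmidt
derivation D has a logarithmic derivative ε = D⁻¹χ(D), and its coefficients are ordinary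
derivations, since D acts on A[[s]]_Δ by a ring automorphism (`HS.exists_derivation`). Over ℚ the
equation χ(U) = Uε with U_0 = 1 and ε_0 = 0 reads |α|U_α = ∑ U_β ε_γ with γ ≠ 0, and so has exactly
one solution (`exists_chi_eq_mul`, `chi_eq_mul_unique`). Hence D is recovered from its derivations,
and Ψ(D) should be the solution obtained by applying ∇ to the coefficients of ε.

To see that this Ψ is a HS-structure, D and Ψ(D) are treated as one series over End_k(A) × R, whose
logarithmic derivative lies in the graph L of ∇. The graph is a Lie subalgebra stable under A, and
commutators of the image of A with L stay in the image of A. The series with logarithmic derivative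
in L are closed under products (`HasLogIn.mul`), and under substitutions when series over A can be
moved across the result (`HasLogIn.bullet`). Such a series is determined by its first component
(`hasLogIn_unique`), because a derivation determines its point on the graph. Multiplicativity of Ψ
and its compatibility with substitutions therefore follow from the same facts for D. The Leibniz
rule follows likewise, from conjugation preserving series with coefficients in the image of A
(`HasLogIn.exists_mul_eq`).

Conversely, let Ψ be a HS-structure and Ψ(Id + δs) = 1 + ∇(δ)s. Products, the substitutions s ↦ as
and a commutator in two variables show that ∇ is LR-admissible. Modulo t², the substitution s_i ↦
s_i(1 + t) turns D into D + tχ(D) = D(1 + tε), and, up to any given order, 1 + tε is a finite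
product of substituted series Id + δs. Applying Ψ gives χ(Ψ(D)) = Ψ(D)∇(ε) (`HSStructure.chi_eq`),
so ∇ determines Ψ.

For morphisms, the recursion for Ψ(D)_α stays inside any subalgebra containing all ∇(δ). Applied to
the algebra of pairs of operators intertwined by f, it shows that horizontal maps are HS-maps. Left
and right modules differ only in the choice of R. -/

namespace HSMod

/-! ### Complements on truncated power series -/

namespace TPS

section Ring

variable {p : ℕ} {R : Type u} [Ring R] {S : Type v} [Ring S] {Δ : Coideal p}

theorem coeff_mul_of_forall {α : Fin p →₀ ℕ} (x y : TPS R Δ) (M : AddSubgroup R)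
    (h : ∀ c ∈ antidiagonal α, coeff c.1 x * coeff c.2 y ∈ M) : coeff α (x * y) ∈ M := by
  by_cases hα : α ∈ Δ
  · rw [coeff_mul hα]
    exact M.sum_mem h
  · rw [coeff_of_notMem hα]
    exact M.zero_mem

theorem coeff_neg (α : Fin p →₀ ℕ) (x : TPS R Δ) : coeff α (-x) = -coeff α x :=
  map_neg (coeffHom Δ α) x

theorem coeff_nsmul (α : Fin p →₀ ℕ) (n : ℕ) (x : TPS R Δ) : coeff α (n • x) = n • coeff α x :=
  map_nsmul (coeffHom Δ α) n x

theorem monomial_of_notMem {α : Fin p →₀ ℕ} (hα : α ∉ Δ) (r : R) : monomial Δ α r = 0 := by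
  refine ext fun β hβ => ?_
  rw [coeff_monomial hβ, coeff_zero, if_neg]
  rintro rfl
  exact hα hβ

theorem monomial_mul_monomial (α β : Fin p →₀ ℕ) (r s : R) :
    monomial Δ α r * monomial Δ β s = monomial Δ (α + β) (r * s) := by
  rw [monomial, monomial, monomial, ← map_mul, MvPowerSeries.monomial_mul_monomial]

theorem monomial_add (α : Fin p →₀ ℕ) (r s : R) :
    monomial Δ α (r + s) = monomial Δ α r + monomial Δ α s := by
  rw [monomial, monomial, monomial, ← _root_.map_add, _root_.map_add]

theorem monomial_zero (α : Fin p →₀ ℕ) : monomial Δ α (0 : R) = 0 := by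
  rw [monomial, map_zero, map_zero]

theorem monomial_zero_one : monomial Δ 0 (1 : R) = 1 := by
  rw [monomial, MvPowerSeries.monomial_zero_one, map_one]

theorem coeff_mul_monomial {α : Fin p →₀ ℕ} (hα : α ∈ Δ) (β : Fin p →₀ ℕ) (x : TPS R Δ) (r : R) :
    coeff α (x * monomial Δ β r) = if β ≤ α then coeff (α - β) x * r else 0 := by
  classical
  obtain ⟨f, rfl⟩ := Ideal.Quotient.mk_surjective x
  rw [monomial, ← map_mul, coeff_mk' hα, MvPowerSeries.coeff_mul_monomial]
  split_ifs
  · rw [coeff_mk' (Coideal.mem_of_le hα tsub_le_self)]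
  · rfl

theorem coeff_monomial_mul {α : Fin p →₀ ℕ} (hα : α ∈ Δ) (β : Fin p →₀ ℕ) (x : TPS R Δ) (r : R) :
    coeff α (monomial Δ β r * x) = if β ≤ α then r * coeff (α - β) x else 0 := by
  classical
  obtain ⟨f, rfl⟩ := Ideal.Quotient.mk_surjective x
  rw [monomial, ← map_mul, coeff_mk' hα, MvPowerSeries.coeff_monomial_mul]
  split_ifs
  · rw [coeff_mk' (Coideal.mem_of_le hα tsub_le_self)]
  · rfl

theorem coeff_mul_const (α : Fin p →₀ ℕ) (x : TPS R Δ) (r : R) :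
    coeff α (x * monomial Δ 0 r) = coeff α x * r := by
  by_cases hα : α ∈ Δ
  · rw [coeff_mul_monomial hα, if_pos zero_le, tsub_zero]
  · rw [coeff_of_notMem hα, coeff_of_notMem hα, zero_mul]

theorem coeff_const_mul (α : Fin p →₀ ℕ) (x : TPS R Δ) (r : R) :
    coeff α (monomial Δ 0 r * x) = r * coeff α x := by
  by_cases hα : α ∈ Δ
  · rw [coeff_monomial_mul hα, if_pos zero_le, tsub_zero]
  · rw [coeff_of_notMem hα, coeff_of_notMem hα, mul_zero]

theorem monomial_one_mul_comm (β : Fin p →₀ ℕ) (x : TPS R Δ) :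
    monomial Δ β 1 * x = x * monomial Δ β 1 := by
  refine ext fun α hα => ?_
  rw [coeff_mul_monomial hα, coeff_monomial_mul hα]
  simp

theorem monomial_eq_mul_const (β : Fin p →₀ ℕ) (r : R) :
    monomial Δ β r = monomial Δ β 1 * monomial Δ 0 r := by
  rw [monomial_mul_monomial, add_zero, one_mul]

/-- The ring homomorphism between rings of truncated power series induced by a ring
homomorphism between the coefficients. -/
noncomputable def map (Δ : Coideal p) (f : R →+* S) : TPS R Δ →+* TPS S Δ :=
  Ideal.Quotient.lift (truncIdeal R Δ)
    ((Ideal.Quotient.mk (truncIdeal S Δ)).comp (MvPowerSeries.map f)) fun x hx => by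
      rw [RingHom.comp_apply, Ideal.Quotient.eq_zero_iff_mem]
      intro α hα
      rw [MvPowerSeries.coeff_map, hx α hα, map_zero]

theorem coeff_map (f : R →+* S) (α : Fin p →₀ ℕ) (x : TPS R Δ) :
    coeff α (map Δ f x) = f (coeff α x) := by
  by_cases hα : α ∈ Δ
  · obtain ⟨x, rfl⟩ := Ideal.Quotient.mk_surjective x
    rw [map, Ideal.Quotient.lift_mk, RingHom.comp_apply, coeff_mk' hα, coeff_mk' hα,
      MvPowerSeries.coeff_map]
  · rw [coeff_of_notMem hα, coeff_of_notMem hα, map_zero]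

theorem map_monomial (f : R →+* S) (α : Fin p →₀ ℕ) (r : R) :
    map Δ f (monomial Δ α r) = monomial Δ α (f r) := by
  refine ext fun β hβ => ?_
  rw [coeff_map, coeff_monomial hβ, coeff_monomial hβ]
  split_ifs
  · rfl
  · exact map_zero f

/-- The derivation `∑ r_α s^α ↦ ∑ θ(α) r_α s^α` attached to a weight `θ`. -/
noncomputable def euler (θ : (Fin p →₀ ℕ) →+ ℕ) : TPS R Δ →+ TPS R Δ :=
  AddMonoidHom.mk' (fun x => mk Δ fun α => θ α • coeff α x) fun x y => by
    refine ext fun α hα => ?_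
    rw [coeff_add, coeff_mk hα, coeff_mk hα, coeff_mk hα, coeff_add, smul_add]

theorem coeff_euler (θ : (Fin p →₀ ℕ) →+ ℕ) (α : Fin p →₀ ℕ) (x : TPS R Δ) :
    coeff α (euler θ x) = θ α • coeff α x := by
  by_cases hα : α ∈ Δ
  · exact coeff_mk hα _
  · rw [coeff_of_notMem hα, coeff_of_notMem hα, smul_zero]

theorem euler_mul (θ : (Fin p →₀ ℕ) →+ ℕ) (x y : TPS R Δ) :
    euler θ (x * y) = euler θ x * y + x * euler θ y := by
  refine ext fun α hα => ?_
  rw [coeff_add, coeff_euler, coeff_mul hα, coeff_mul hα, coeff_mul hα, Finset.smul_sum,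
    ← Finset.sum_add_distrib]
  refine Finset.sum_congr rfl fun c hc => ?_
  rw [coeff_euler, coeff_euler, ← mem_antidiagonal.mp hc, _root_.map_add, add_smul, smul_mul_assoc,
    mul_smul_comm]

theorem euler_monomial (θ : (Fin p →₀ ℕ) →+ ℕ) (α : Fin p →₀ ℕ) (r : R) :
    euler θ (monomial Δ α r) = θ α • monomial Δ α r := by
  refine ext fun β hβ => ?_
  rw [coeff_euler, coeff_nsmul, coeff_monomial hβ]
  split_ifs with h
  · rw [h]
  · rw [smul_zero, smul_zero]

theorem euler_one (θ : (Fin p →₀ ℕ) →+ ℕ) : euler θ (1 : TPS R Δ) = 0 := by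
  rw [← monomial_zero_one, euler_monomial, map_zero, zero_smul]

theorem euler_map (θ : (Fin p →₀ ℕ) →+ ℕ) (f : R →+* S) (x : TPS R Δ) :
    euler θ (map Δ f x) = map Δ f (euler θ x) := by
  refine ext fun β _ => ?_
  rw [coeff_euler, coeff_map, coeff_map, coeff_euler, map_nsmul]

/-- The total Euler derivation `∑ r_α s^α ↦ ∑ |α| r_α s^α`. -/
noncomputable abbrev chi : TPS R Δ →+ TPS R Δ := euler Finsupp.degree

/-- The series without terms of degree at most `n`. -/
def highDeg (R : Type u) [Ring R] (Δ : Coideal p) (n : ℕ) : AddSubgroup (TPS R Δ) where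
  carrier := {x | ∀ α : Fin p →₀ ℕ, α.degree ≤ n → coeff α x = 0}
  add_mem' hx hy α hα := by rw [coeff_add, hx α hα, hy α hα, add_zero]
  zero_mem' α _ := coeff_zero α
  neg_mem' hx α hα := by rw [coeff_neg, hx α hα, neg_zero]

theorem degree_fst_le {α : Fin p →₀ ℕ} {c : (Fin p →₀ ℕ) × (Fin p →₀ ℕ)}
    (hc : c ∈ antidiagonal α) : c.1.degree ≤ α.degree := by
  rw [← mem_antidiagonal.mp hc, _root_.map_add]
  exact Nat.le_add_right _ _

theorem degree_snd_le {α : Fin p →₀ ℕ} {c : (Fin p →₀ ℕ) × (Fin p →₀ ℕ)}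
    (hc : c ∈ antidiagonal α) : c.2.degree ≤ α.degree := by
  rw [← mem_antidiagonal.mp hc, _root_.map_add]
  exact Nat.le_add_left _ _

theorem mul_mem_highDeg {n : ℕ} (x : TPS R Δ) {y : TPS R Δ} (hy : y ∈ highDeg R Δ n) :
    x * y ∈ highDeg R Δ n := fun α hα => by
  refine coeff_mul_of_forall x y ⊥ fun c hc => ?_
  rw [hy _ ((degree_snd_le hc).trans hα), mul_zero]
  exact zero_mem _

theorem mul_mem_highDeg' {n : ℕ} {x : TPS R Δ} (hx : x ∈ highDeg R Δ n) (y : TPS R Δ) :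
    x * y ∈ highDeg R Δ n := fun α hα => by
  refine coeff_mul_of_forall x y ⊥ fun c hc => ?_
  rw [hx _ ((degree_fst_le hc).trans hα), zero_mul]
  exact zero_mem _

theorem map_mem_highDeg {n : ℕ} (f : R →+* S) {x : TPS R Δ} (hx : x ∈ highDeg R Δ n) :
    map Δ f x ∈ highDeg S Δ n := fun α hα => by
  rw [coeff_map, hx α hα, map_zero]

theorem euler_mem_highDeg {n : ℕ} (θ : (Fin p →₀ ℕ) →+ ℕ) {x : TPS R Δ}
    (hx : x ∈ highDeg R Δ n) : euler θ x ∈ highDeg R Δ n := fun α hα => by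
  rw [coeff_euler, hx α hα, smul_zero]

end Ring

/-! ### Series with coefficients in a submodule; reduction to monomials. -/

section Coeffs

variable {k : Type w} [CommRing k] {p q : ℕ} {Δ : Coideal p} {Ω : Coideal q}
variable {R : Type u} [Ring R] [Algebra k R] {S : Type v} [Ring S] [Algebra k S]

/-- The series all of whose coefficients lie in a given submodule. -/
def coeffsIn (Δ : Coideal p) (M : Submodule k R) : AddSubgroup (TPS R Δ) where
  carrier := {x | ∀ α : Fin p →₀ ℕ, coeff α x ∈ M}
  add_mem' hx hy α := by
    rw [coeff_add]
    exact M.add_mem (hx α) (hy α)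
  zero_mem' α := by
    rw [coeff_zero]
    exact M.zero_mem
  neg_mem' hx α := by
    rw [coeff_neg]
    exact M.neg_mem (hx α)

theorem monomial_mem_coeffsIn {M : Submodule k R} (α : Fin p →₀ ℕ) {r : R} (hr : r ∈ M) :
    monomial Δ α r ∈ coeffsIn Δ M := fun β => by
  by_cases hβ : β ∈ Δ
  · rw [coeff_monomial hβ]
    split_ifs
    · exact hr
    · exact M.zero_mem
  · rw [coeff_of_notMem hβ]
    exact M.zero_mem

theorem mul_mem_coeffsIn {M N P : Submodule k R} (h : ∀ x ∈ M, ∀ y ∈ N, x * y ∈ P)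
    {x y : TPS R Δ} (hx : x ∈ coeffsIn Δ M) (hy : y ∈ coeffsIn Δ N) :
    x * y ∈ coeffsIn Δ P := fun _ =>
  coeff_mul_of_forall x y P.toAddSubgroup fun _ _ => h _ (hx _) _ (hy _)

theorem eq_zero_of_mem_coeffsIn_bot {x : TPS R Δ}
    (hx : x ∈ coeffsIn Δ (⊥ : Submodule k R)) : x = 0 :=
  ext fun α _ => by rw [(Submodule.mem_bot k).mp (hx α), coeff_zero]

theorem sub_sum_monomial_mem_highDeg (n : ℕ) (x : TPS R Δ) :
    x - ∑ α ∈ degLE p n, monomial Δ α (coeff α x) ∈ highDeg R Δ n := by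
  intro β hβ
  by_cases hβΔ : β ∈ Δ
  · rw [coeff_sub, coeff_sum, Finset.sum_eq_single β, coeff_monomial hβΔ, if_pos rfl, sub_self]
    · intro α _ hne
      rw [coeff_monomial hβΔ, if_neg hne.symm]
    · intro h
      exact absurd (mem_degLE.mpr hβ) h
  · exact coeff_of_notMem hβΔ _

/-- Additive maps that do not lower the order are controlled by their values on monomials. -/
theorem map_mem_coeffsIn {M : Submodule k R} {N : Submodule k S} (f : TPS R Δ →+ TPS S Ω)
    (hf : ∀ n, ∀ x ∈ highDeg R Δ n, f x ∈ highDeg S Ω n)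
    (hm : ∀ γ, ∀ m ∈ M, f (monomial Δ γ m) ∈ coeffsIn Ω N) {x : TPS R Δ}
    (hx : x ∈ coeffsIn Δ M) : f x ∈ coeffsIn Ω N := by
  intro e
  -- Up to order |e|, x is a finite sum of monomials, and f does not lower the order, so only these
  -- contribute to the coefficient at e.
  have hxy := sub_sum_monomial_mem_highDeg e.degree x
  have h1 := hf _ _ hxy e le_rfl
  rw [map_sub, coeff_sub, sub_eq_zero] at h1
  rw [h1, map_sum]
  exact (coeffsIn Ω N).sum_mem (fun α _ => hm α _ (hx α)) e

/-- Two additive maps that do not lower the order agree if they agree on monomials. -/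
theorem addHom_ext_of_monomial {M : Submodule k R} (f g : TPS R Δ →+ TPS S Ω)
    (hf : ∀ n, ∀ x ∈ highDeg R Δ n, f x ∈ highDeg S Ω n)
    (hg : ∀ n, ∀ x ∈ highDeg R Δ n, g x ∈ highDeg S Ω n)
    (hm : ∀ γ, ∀ m ∈ M, f (monomial Δ γ m) = g (monomial Δ γ m)) {x : TPS R Δ}
    (hx : x ∈ coeffsIn Δ M) : f x = g x := by
  rw [← sub_eq_zero]
  refine eq_zero_of_mem_coeffsIn_bot (k := k) (map_mem_coeffsIn (M := M) (f - g) ?_ ?_ hx)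
  · intro n x hx
    exact (highDeg S Ω n).sub_mem (hf n x hx) (hg n x hx)
  · intro γ m hm'
    rw [AddMonoidHom.sub_apply, hm γ m hm', sub_self]
    exact zero_mem _

theorem mem_coeffsIn_top (x : TPS R Δ) : x ∈ coeffsIn Δ (⊤ : Submodule k R) :=
  fun _ => Submodule.mem_top

end Coeffs

end TPS

/-! ### Logarithmic derivatives -/

section Log

variable {k : Type w} [CommRing k] {p : ℕ} {Δ : Coideal p}
variable {R : Type u} [Ring R] [Algebra k R]

/-- The inverse of n exists in k. Every induction on the degree below divides by |α| through this
lemma. -/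
theorem mem_of_nsmul_mem [Algebra ℚ k] (M : Submodule k R) {n : ℕ} (hn : n ≠ 0) {x : R}
    (h : n • x ∈ M) : x ∈ M := by
  have h1 : algebraMap ℚ k (n : ℚ)⁻¹ * (n : k) = 1 := by
    rw [← map_natCast (algebraMap ℚ k), ← map_mul, inv_mul_cancel₀ (Nat.cast_ne_zero.mpr hn),
      map_one]
  have h2 := M.smul_mem (algebraMap ℚ k (n : ℚ)⁻¹) h
  rwa [← Nat.cast_smul_eq_nsmul k, smul_smul, h1, one_smul] at h2

namespace TPS

/-- The solutions of `χ(V) + c V = [V, ε] + r` have coefficients in `M` if `r` has, `ε` has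
coefficients in `L` and `[M, L] ⊆ M`. -/
theorem mem_coeffsIn_of_chi [Algebra ℚ k] {L M : Submodule k R}
    (hML : ∀ m ∈ M, ∀ l ∈ L, m * l - l * m ∈ M) {V ε r : TPS R Δ} (c : ℕ)
    (hV : chi V + c • V = V * ε - ε * V + r) (hε : ε ∈ coeffsIn Δ L) (hε0 : coeff 0 ε = 0)
    (hr : r ∈ coeffsIn Δ M) (h0 : c ≠ 0 ∨ coeff 0 V ∈ M) : V ∈ coeffsIn Δ M := by
  intro α
  induction hn : α.degree using Nat.strong_induction_on generalizing α with
  | _ n ih =>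
    subst hn
    -- The coefficient at α reads (|α| + c)V_α = ∑ [V_β, ε_γ] + r_α, where γ = 0 contributes
    -- nothing. One can divide unless α = 0 and c = 0, the case covered by `h0`.
    by_cases hc : α.degree + c = 0
    · rw [Nat.add_eq_zero_iff, Finsupp.degree_eq_zero_iff] at hc
      rw [hc.1]
      exact h0.resolve_left fun h => h hc.2
    by_cases hα : α ∈ Δ
    swap
    · rw [coeff_of_notMem hα]
      exact M.zero_mem
    refine mem_of_nsmul_mem M hc ?_
    have h := congrArg (coeff α) hV
    -- Indexing both products by the same pairs turns their difference into a sum of commutators.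
    have hs : coeff α (ε * V) = ∑ c ∈ antidiagonal α, coeff c.2 ε * coeff c.1 V := by
      rw [coeff_mul hα]
      refine Finset.sum_nbij' Prod.swap Prod.swap ?_ ?_ ?_ ?_ ?_ <;> simp [add_comm]
    rw [coeff_add, coeff_add, coeff_sub, coeff_nsmul, coeff_euler, ← add_smul, coeff_mul hα,
      hs, ← Finset.sum_sub_distrib] at h
    rw [h]
    refine M.add_mem (M.sum_mem fun c hc => ?_) (hr α)
    by_cases hc2 : c.2 = 0
    · rw [hc2, hε0, mul_zero, zero_mul, sub_zero]
      exact M.zero_mem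
    · refine hML _ (ih _ ?_ c.1 rfl) _ (hε _)
      rw [← mem_antidiagonal.mp hc, _root_.map_add]
      have := mt (Finsupp.degree_eq_zero_iff c.2).mp hc2
      omega

/-- Since ε_0 = 0, |α|V_α involves only V_β with |β| < |α|, so vanishing propagates from degree 0.
-/
theorem eq_zero_of_chi [Algebra ℚ k] {V ε : TPS R Δ} (hV : chi V = V * ε)
    (hε0 : coeff 0 ε = 0) (h0 : coeff 0 V = 0) : V = 0 := by
  refine ext fun α hα => ?_
  rw [coeff_zero]
  induction hn : α.degree using Nat.strong_induction_on generalizing α with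
  | _ n ih =>
    subst hn
    by_cases hc : α.degree = 0
    · rwa [(Finsupp.degree_eq_zero_iff _).mp hc]
    -- Division by |α| is membership in the zero submodule.
    rw [← Submodule.mem_bot (R := k)]
    refine mem_of_nsmul_mem _ hc ?_
    have h := congrArg (coeff α) hV
    rw [coeff_euler, coeff_mul hα] at h
    rw [h]
    refine Submodule.sum_mem _ fun c hc => ?_
    rw [Submodule.mem_bot]
    by_cases hc2 : c.2 = 0
    · rw [hc2, hε0, mul_zero]
    · rw [ih _ ?_ c.1 (Coideal.mem_of_le hα (fst_le_of_mem hc)) rfl, zero_mul]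
      rw [← mem_antidiagonal.mp hc, _root_.map_add]
      have := mt (Finsupp.degree_eq_zero_iff c.2).mp hc2
      omega

theorem chi_eq_mul_unique [Algebra ℚ k] {U V ε : TPS R Δ} (hU : chi U = U * ε)
    (hV : chi V = V * ε) (hε0 : coeff 0 ε = 0) (h0 : coeff 0 U = coeff 0 V) : U = V := by
  rw [← sub_eq_zero]
  refine eq_zero_of_chi (k := k) (ε := ε) ?_ hε0 ?_
  · rw [map_sub, hU, hV, sub_mul]
  · rw [coeff_sub, h0, sub_self]

/-- χ kills constant terms. This is what removes the term γ = 0 from all the recursions. -/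
theorem coeff_zero_of_chi {U ε : TPS R Δ} (hU : chi U = U * ε) (h0 : coeff 0 U = 1) :
    coeff 0 ε = 0 := by
  have h := congrArg (coeff 0) hU
  rw [coeff_euler, map_zero, zero_smul, coeff_zero_mul, h0, one_mul] at h
  exact h.symm

/-- The coefficients of the solution of `χ(U) = U ε` with `U_0 = 1`. -/
noncomputable def expCoeff (k : Type w) [CommRing k] [Algebra ℚ k] [Algebra k R]
    (ε : (Fin p →₀ ℕ) → R) (α : Fin p →₀ ℕ) : R :=
  if α = 0 then 1 else
    algebraMap ℚ k (α.degree : ℚ)⁻¹ • ∑ c ∈ (antidiagonal α).attach,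
      -- The omitted term has factor ε_0, which is 0 in every use; keeping it would make the
      -- recursion circular.
      if h : c.1.2 = 0 then 0 else
        have : c.1.1.degree < α.degree := by
          have h1 := congrArg Finsupp.degree (mem_antidiagonal.mp c.2)
          rw [_root_.map_add] at h1
          have := mt (Finsupp.degree_eq_zero_iff c.1.2).mp h
          omega
        expCoeff k ε c.1.1 * ε c.1.2
termination_by α.degree

/-- Integration of a logarithmic derivative: solve |α|U_α = ∑ U_β ε_γ degree by degree. The result
plays the role of an ordered exponential. -/
theorem exists_chi_eq_mul [Algebra ℚ k] {ε : TPS R Δ} (hε0 : coeff 0 ε = 0) :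
    ∃ U : TPS R Δ, coeff 0 U = 1 ∧ chi U = U * ε := by
  have h0 : coeff 0 (mk Δ (expCoeff k fun α => coeff α ε)) = 1 := by
    rw [coeff_mk Δ.zero_mem, expCoeff, if_pos rfl]
  refine ⟨mk Δ (expCoeff k fun α => coeff α ε), h0, ext fun α hα => ?_⟩
  rw [coeff_euler]
  by_cases hc : α = 0
  · rw [hc, map_zero, zero_smul, coeff_zero_mul, hε0, mul_zero]
  have hd : (α.degree : ℚ) ≠ 0 :=
    Nat.cast_ne_zero.mpr (mt (Finsupp.degree_eq_zero_iff α).mp hc)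
  rw [coeff_mk hα, expCoeff, if_neg hc, ← Nat.cast_smul_eq_nsmul k, smul_smul,
    ← map_natCast (algebraMap ℚ k), ← map_mul, mul_inv_cancel₀ hd, map_one, one_smul,
    coeff_mul hα, ← Finset.sum_attach (antidiagonal α)]
  refine Finset.sum_congr rfl fun c _ => ?_
  split_ifs with h
  · rw [h, hε0, mul_zero]
  · rw [coeff_mk (Coideal.mem_of_le hα (fst_le_of_mem c.2))]

end TPS

/-- The series `U` with constant coefficient `1` whose logarithmic derivative `U⁻¹ χ(U)` has
coefficients in `L`. -/
def HasLogIn (L : Submodule k R) (U : TPS R Δ) : Prop :=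
  TPS.coeff 0 U = 1 ∧ ∃ ε ∈ TPS.coeffsIn Δ L, TPS.chi U = U * ε

variable {L M : Submodule k R}

theorem HasLogIn.isUnit {U : TPS R Δ} (hU : HasLogIn L U) : IsUnit U :=
  TPS.isUnit_of_coeff_zero hU.1

open TPS in
/-- Conjugation by `U` preserves the series with coefficients in `M`. -/
theorem HasLogIn.exists_mul_eq [Algebra ℚ k] (hML : ∀ m ∈ M, ∀ l ∈ L, m * l - l * m ∈ M)
    {U : TPS R Δ} (hU : HasLogIn L U) {x : TPS R Δ} (hx : x ∈ coeffsIn Δ M) :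
    ∃ y ∈ coeffsIn Δ M, U * y = x * U := by
  obtain ⟨u, rfl⟩ := hU.isUnit
  obtain ⟨h0, ε, hε, hUε⟩ := hU
  refine ⟨↑u⁻¹ * (x * u), ?_, by rw [Units.mul_inv_cancel_left]⟩
  -- Conjugation does not lower the order, so monomials suffice; as s^γ is central, these reduce to
  -- the constants m treated in `key`.
  refine map_mem_coeffsIn (M := M)
    ((AddMonoidHom.mulLeft (↑u⁻¹ : TPS R Δ)).comp (AddMonoidHom.mulRight (u : TPS R Δ)))
    (fun n y hy => mul_mem_highDeg _ (mul_mem_highDeg' hy _)) (fun γ m hm => ?_) hx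
  have key : (↑u⁻¹ * (monomial Δ 0 m * u) : TPS R Δ) ∈ coeffsIn Δ M := by
    -- Applying χ to uV = mu, with χ(m) = 0 and χ(u) = uε, gives χ(V) = [V, ε]. The constant term of
    -- V is m.
    generalize hV : (↑u⁻¹ * (monomial Δ 0 m * u) : TPS R Δ) = V
    have huV : u * V = monomial Δ 0 m * u := by rw [← hV, Units.mul_inv_cancel_left]
    have h1 := congrArg chi huV
    rw [euler_mul, euler_mul, euler_monomial, map_zero, zero_smul, zero_mul, zero_add, hUε,
      ← mul_assoc, ← huV, mul_assoc, mul_assoc, ← mul_add, Units.mul_right_inj] at h1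
    refine mem_coeffsIn_of_chi hML (ε := ε) (r := 0) 0 ?_ hε (coeff_zero_of_chi hUε h0)
      (zero_mem _) (Or.inr ?_)
    · rw [zero_smul, add_zero, add_zero, ← h1, add_sub_cancel_left]
    · have h2 := congrArg (coeff 0) huV
      rw [coeff_zero_mul, coeff_zero_mul, h0, one_mul, mul_one, coeff_monomial Δ.zero_mem,
        if_pos rfl] at h2
      rwa [h2]
  have h3 : (↑u⁻¹ * (monomial Δ γ m * u) : TPS R Δ) =
      monomial Δ γ (1 : R) * (↑u⁻¹ * (monomial Δ 0 m * ↑u) : TPS R Δ) := by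
    have hc := monomial_one_mul_comm γ (↑u⁻¹ : TPS R Δ)
    rw [monomial_eq_mul_const γ m, mul_assoc, ← mul_assoc _ (monomial Δ γ 1), ← hc, mul_assoc]
  change (↑u⁻¹ * (monomial Δ γ m * u) : TPS R Δ) ∈ _
  rw [h3]
  refine mul_mem_coeffsIn (M := Submodule.span k {1}) (N := M) ?_
    (monomial_mem_coeffsIn γ (Submodule.mem_span_singleton_self 1)) key
  intro x hx y hy
  obtain ⟨c, rfl⟩ := Submodule.mem_span_singleton.mp hx
  rw [smul_mul_assoc, one_mul]
  exact M.smul_mem c hy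

open TPS in
-- If χ(U) = Uε and χ(V) = Vε'', then χ(UV) = UV(V⁻¹εV + ε''), and conjugation by V preserves
-- coefficients in L.
theorem HasLogIn.mul [Algebra ℚ k] (hL : ∀ m ∈ L, ∀ l ∈ L, m * l - l * m ∈ L)
    {U V : TPS R Δ} (hU : HasLogIn L U) (hV : HasLogIn L V) : HasLogIn L (U * V) := by
  obtain ⟨h0, ε, hε, hUε⟩ := hU
  obtain ⟨ε', hε', hVε'⟩ := hV.exists_mul_eq hL hε
  obtain ⟨h0', ε'', hε'', hVε''⟩ := hV
  refine ⟨by rw [coeff_zero_mul, h0, h0', one_mul], ε' + ε'', add_mem hε' hε'', ?_⟩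
  rw [euler_mul, hUε, hVε'', mul_assoc, ← hVε']
  simp only [mul_add, mul_assoc]

end Log

/-! ### The action of substitution maps -/

section Bullet

variable {A : Type v} [CommRing A] {p q : ℕ} {Δ : Coideal p} {Ω : Coideal q}
variable {R : Type w} [Ring R] {S : Type u} [Ring S]

open TPS

theorem degree_eq_zero_of_mem_degLE {α : Fin p →₀ ℕ} (h : α ∈ degLE p 0) : α = 0 :=
  (Finsupp.degree_eq_zero_iff α).mp (Nat.le_zero.mp (mem_degLE.mp h))

/-- The action of a substitution map, as an additive map. -/
noncomputable def bulletHom (ι : A →+* R) (φ : SubstMap A Δ Ω) : TPS R Δ →+ TPS R Ω :=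
  AddMonoidHom.mk' (bullet ι φ) fun x y => by
    refine TPS.ext fun e he => ?_
    rw [coeff_add, coeff_bullet _ _ _ he, coeff_bullet _ _ _ he, coeff_bullet _ _ _ he,
      ← Finset.sum_add_distrib]
    simp only [coeff_add, mul_add]

theorem bulletHom_apply (ι : A →+* R) (φ : SubstMap A Δ Ω) (x : TPS R Δ) :
    bulletHom ι φ x = bullet ι φ x := rfl

theorem coeff_bullet_eq_zero (ι : A →+* R) (φ : SubstMap A Δ Ω) {x : TPS R Δ} {e : Fin q →₀ ℕ}
    (hx : ∀ α : Fin p →₀ ℕ, α.degree ≤ e.degree → coeff α x = 0) : coeff e (bullet ι φ x) = 0 := by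
  by_cases he : e ∈ Ω
  · rw [coeff_bullet _ _ _ he]
    refine Finset.sum_eq_zero fun α hα => ?_
    rw [hx α (mem_degLE.mp hα), mul_zero]
  · exact coeff_of_notMem he _

theorem bullet_mem_highDeg (ι : A →+* R) (φ : SubstMap A Δ Ω) {n : ℕ} {x : TPS R Δ}
    (hx : x ∈ highDeg R Δ n) : bullet ι φ x ∈ highDeg R Ω n := fun _ he =>
  coeff_bullet_eq_zero ι φ fun α hα => hx α (hα.trans he)

theorem coeff_zero_bullet (ι : A →+* R) (φ : SubstMap A Δ Ω) (x : TPS R Δ) :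
    coeff 0 (bullet ι φ x) = coeff 0 x := by
  rw [coeff_bullet _ _ _ Ω.zero_mem, Finset.sum_eq_single 0]
  · rw [TPS.monomial_zero_one, map_one, coeff_zero_one, map_one, one_mul]
  · intro α hα h
    rw [map_zero] at hα
    exact absurd (degree_eq_zero_of_mem_degLE hα) h
  · intro h
    exact absurd (mem_degLE.mpr (by simp)) h

theorem bullet_mul_const (ι : A →+* R) (φ : SubstMap A Δ Ω) (x : TPS R Δ) (r : R) :
    bullet ι φ (x * monomial Δ 0 r) = bullet ι φ x * monomial Ω 0 r := by
  refine TPS.ext fun e he => ?_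
  rw [coeff_mul_const, coeff_bullet _ _ _ he, coeff_bullet _ _ _ he, Finset.sum_mul]
  simp only [coeff_mul_const, mul_assoc]

theorem bullet_map (ι : A →+* R) (φ : SubstMap A Δ Ω) (x : TPS A Δ) :
    bullet ι φ (map Δ ι x) = map Ω ι (φ.toAlgHom x) := by
  refine TPS.ext fun e he => ?_
  rw [TPS.coeff_map, φ.coeff_apply he, map_sum, coeff_bullet _ _ _ he]
  simp only [TPS.coeff_map, map_mul]

theorem bullet_monomial (ι : A →+* R) (φ : SubstMap A Δ Ω) (α : Fin p →₀ ℕ) (r : R) :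
    bullet ι φ (monomial Δ α r) =
      map Ω ι (φ.toAlgHom (monomial Δ α 1)) * monomial Ω 0 r := by
  rw [monomial_eq_mul_const, bullet_mul_const, ← bullet_map, TPS.map_monomial, map_one]

/-- The series φ(s^α) stand on the left of the coefficients, and elements of A need not commute with
R. So φ• need not be multiplicative, but it is semilinear over series from A on the left and linear
over constants of R on the right (`bullet_mul_const`). -/
theorem bullet_map_mul (ι : A →+* R) (φ : SubstMap A Δ Ω) (x : TPS A Δ) (r : TPS R Δ) :
    bullet ι φ (map Δ ι x * r) = map Ω ι (φ.toAlgHom x) * bullet ι φ r := by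
  refine addHom_ext_of_monomial (k := ℤ) (M := ⊤)
    ((bulletHom ι φ).comp (AddMonoidHom.mulLeft (map Δ ι x)))
    ((AddMonoidHom.mulLeft (map Ω ι (φ.toAlgHom x))).comp (bulletHom ι φ))
    (fun n y hy => bullet_mem_highDeg ι φ (mul_mem_highDeg _ hy))
    (fun n y hy => mul_mem_highDeg _ (bullet_mem_highDeg ι φ hy)) (fun γ m _ => ?_)
    (mem_coeffsIn_top r)
  change bullet ι φ (map Δ ι x * monomial Δ γ m) =
    map Ω ι (φ.toAlgHom x) * bullet ι φ (monomial Δ γ m)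
  rw [bullet_monomial, ← mul_assoc, ← map_mul, ← map_mul, ← bullet_map, ← bullet_mul_const,
    map_mul, TPS.map_monomial, map_one, mul_assoc, ← monomial_eq_mul_const]

theorem map_bullet (ι : A →+* R) (φ : SubstMap A Δ Ω) (f : R →+* S) (r : TPS R Δ) :
    map Ω f (bullet ι φ r) = bullet (f.comp ι) φ (map Δ f r) := by
  refine TPS.ext fun e he => ?_
  rw [TPS.coeff_map, coeff_bullet _ _ _ he, coeff_bullet _ _ _ he, map_sum]
  simp only [TPS.coeff_map, map_mul, RingHom.comp_apply]

/-- The co-ideal of all multi-indices. -/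
def Coideal.all (p : ℕ) : Coideal p where
  carrier := Set.univ
  nonempty := ⟨0, trivial⟩
  lower := fun _ _ => trivial

theorem Coideal.mem_all (α : Fin p →₀ ℕ) : α ∈ Coideal.all p := trivial

/-! ### Formal partial derivatives of untruncated series, and the chain rule. -/

namespace TPS

/-- The partial derivative with respect to `s_i`. -/
noncomputable def pd (i : Fin p) : TPS R (Coideal.all p) →+ TPS R (Coideal.all p) :=
  AddMonoidHom.mk' (fun x => mk _ fun α => (α i + 1) • coeff (α + Finsupp.single i 1) x)
    fun x y => by
      refine TPS.ext fun α hα => ?_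
      rw [coeff_add, coeff_mk hα, coeff_mk hα, coeff_mk hα, coeff_add, smul_add]

theorem coeff_pd (i : Fin p) (α : Fin p →₀ ℕ) (x : TPS R (Coideal.all p)) :
    coeff α (pd i x) = (α i + 1) • coeff (α + Finsupp.single i 1) x :=
  coeff_mk (Coideal.mem_all α) _

theorem coeff_add_X_mul (i : Fin p) (α : Fin p →₀ ℕ) (x : TPS R (Coideal.all p)) :
    coeff (α + Finsupp.single i 1) (X (Coideal.all p) i * x) = coeff α x := by
  rw [X, coeff_monomial_mul (Coideal.mem_all _), if_pos le_add_self, one_mul, add_tsub_cancel_right]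

theorem X_mul_left_injective (i : Fin p) {x y : TPS R (Coideal.all p)}
    (h : X (Coideal.all p) i * x = X (Coideal.all p) i * y) : x = y := by
  refine TPS.ext fun α _ => ?_
  rw [← coeff_add_X_mul i, h, coeff_add_X_mul]

theorem X_mul_pd (i : Fin p) (x : TPS R (Coideal.all p)) :
    X (Coideal.all p) i * pd i x = euler (Finsupp.applyAddHom i) x := by
  refine TPS.ext fun α hα => ?_
  rw [coeff_euler, X, coeff_monomial_mul hα, one_mul, Finsupp.applyAddHom_apply]
  split_ifs with h
  · have h1 : 1 ≤ α i := by simpa using h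
    rw [coeff_pd, tsub_add_cancel_of_le h, Finsupp.tsub_apply, Finsupp.single_eq_same,
      Nat.sub_add_cancel h1]
  · have h1 : α i = 0 := by
      by_contra h2
      exact h (Finsupp.single_le_iff.mpr (Nat.one_le_iff_ne_zero.mpr h2))
    rw [h1, zero_smul]

/-- s_i∂_i is the Euler derivation of the weight α ↦ α_i, and s_i is central and can be cancelled
because nothing is truncated. -/
theorem pd_mul (i : Fin p) (x y : TPS R (Coideal.all p)) :
    pd i (x * y) = pd i x * y + x * pd i y := by
  apply X_mul_left_injective i
  rw [X_mul_pd, euler_mul, ← X_mul_pd, ← X_mul_pd, mul_add, mul_assoc, ← mul_assoc x,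
    X, ← monomial_one_mul_comm _ x, mul_assoc]

theorem pd_mul_const (i : Fin p) (x : TPS R (Coideal.all p)) (r : R) :
    pd i (x * monomial _ 0 r) = pd i x * monomial _ 0 r := by
  refine TPS.ext fun α hα => ?_
  rw [coeff_mul_const, coeff_pd, coeff_pd, coeff_mul_const, smul_mul_assoc]

theorem pd_map (i : Fin p) (f : R →+* S) (x : TPS R (Coideal.all p)) :
    pd i (map _ f x) = map _ f (pd i x) := by
  refine TPS.ext fun α hα => ?_
  rw [TPS.coeff_map, coeff_pd, coeff_pd, TPS.coeff_map, map_nsmul]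

/-- ∂_i lowers the degree by one, whence the extra term; it becomes the constant c = 1 in
`mem_coeffsIn_of_chi`. -/
theorem chi_pd (i : Fin p) (x : TPS R (Coideal.all p)) :
    chi (pd i x) + pd i x = pd i (chi x) := by
  refine TPS.ext fun α hα => ?_
  rw [coeff_add, coeff_euler, coeff_pd, coeff_pd, coeff_euler, _root_.map_add,
    Finsupp.degree_single, smul_smul, smul_smul, ← add_smul]
  congr 1
  ring

theorem pd_one (i : Fin p) : pd i (1 : TPS R (Coideal.all p)) = 0 := by
  refine TPS.ext fun α hα => ?_
  rw [coeff_pd, coeff_one (Coideal.mem_all _), if_neg, smul_zero, TPS.coeff_zero]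
  intro h
  have := DFunLike.congr_fun h i
  simp at this

theorem pd_X (i j : Fin p) :
    pd i (X (R := R) (Coideal.all p) j) = if i = j then 1 else 0 := by
  refine TPS.ext fun α hα => ?_
  rw [coeff_pd, X, coeff_monomial (Coideal.mem_all _)]
  by_cases hij : i = j
  · subst hij
    rw [if_pos rfl, coeff_one hα]
    by_cases h : α = 0
    · simp [h]
    · rw [if_neg h, if_neg, smul_zero]
      simpa using h
  · rw [if_neg hij, TPS.coeff_zero, if_neg, smul_zero]
    intro h
    have := DFunLike.congr_fun h i
    simp [Finsupp.single_eq_of_ne hij] at this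

/-- A factor without constant term regains the one degree that ∂_i loses, so the right side of the
chain rule does not lower the order. -/
theorem mul_mem_highDeg_of_coeff_zero {n : ℕ} {x y : TPS R Δ} (hx : coeff 0 x = 0)
    (hy : ∀ α : Fin p →₀ ℕ, α.degree < n → coeff α y = 0) : x * y ∈ highDeg R Δ n := fun α hα => by
  refine coeff_mul_of_forall x y ⊥ fun c hc => ?_
  rw [AddSubgroup.mem_bot]
  by_cases h : c.1 = 0
  · rw [h, hx, zero_mul]
  · rw [hy, mul_zero]
    have h1 := congrArg Finsupp.degree (mem_antidiagonal.mp hc)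
    rw [_root_.map_add] at h1
    have := mt (Finsupp.degree_eq_zero_iff c.1).mp h
    omega

end TPS

/-- Chain rule for a substitution. Both sides obey the Leibniz rule along φ, so the identity passes
to products from 1 and the variables. -/
theorem chi_substMap_monomial (φ : SubstMap A (Coideal.all p) Ω) (γ : Fin p →₀ ℕ) :
    chi (φ.toAlgHom (monomial _ γ 1)) =
      ∑ i, chi (φ.toAlgHom (X _ i)) * φ.toAlgHom (pd i (monomial _ γ 1)) := by
  have hmul : ∀ y z : TPS A (Coideal.all p),
      chi (φ.toAlgHom y) = ∑ i, chi (φ.toAlgHom (X _ i)) * φ.toAlgHom (pd i y) →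
      chi (φ.toAlgHom z) = ∑ i, chi (φ.toAlgHom (X _ i)) * φ.toAlgHom (pd i z) →
      chi (φ.toAlgHom (y * z)) =
        ∑ i, chi (φ.toAlgHom (X _ i)) * φ.toAlgHom (pd i (y * z)) := by
    intro y z hy hz
    rw [map_mul, euler_mul, hy, hz, Finset.sum_mul, Finset.mul_sum, ← Finset.sum_add_distrib]
    refine Finset.sum_congr rfl fun i _ => ?_
    rw [pd_mul, _root_.map_add, map_mul, map_mul]
    ring
  have hone : chi (φ.toAlgHom 1) =
      ∑ i, chi (φ.toAlgHom (X (Coideal.all p) i)) * φ.toAlgHom (pd i 1) := by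
    rw [map_one, euler_one]
    refine (Finset.sum_eq_zero fun i _ => ?_).symm
    rw [pd_one, map_zero, mul_zero]
  induction γ using Finsupp.induction_linear with
  | zero => rw [TPS.monomial_zero_one, hone]
  | add f g hf hg =>
    have h := hmul _ _ hf hg
    rwa [monomial_mul_monomial, one_mul] at h
  | single j n =>
    induction n with
    | zero => rw [Finsupp.single_zero, TPS.monomial_zero_one, hone]
    | succ n ih =>
      have hX : chi (φ.toAlgHom (X _ j)) =
          ∑ i, chi (φ.toAlgHom (X _ i)) * φ.toAlgHom (pd i (X _ j)) := by
        rw [Finset.sum_eq_single j]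
        · rw [pd_X, if_pos rfl, map_one, mul_one]
        · intro i _ hij
          rw [pd_X, if_neg hij, map_zero, mul_zero]
        · intro h
          exact absurd (Finset.mem_univ _) h
      have h := hmul _ _ ih hX
      rwa [X, monomial_mul_monomial, one_mul, ← Finsupp.single_add] at h

/-- Chain rule with coefficients in R: on s^γ m the constant m factors out on the right and leaves
the commutative case. -/
theorem chi_bullet (ι : A →+* R) (φ : SubstMap A (Coideal.all p) Ω) (r : TPS R (Coideal.all p)) :
    chi (bullet ι φ r) =
      ∑ i, map Ω ι (chi (φ.toAlgHom (X _ i))) * bullet ι φ (pd i r) := by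
  have h := addHom_ext_of_monomial (k := ℤ) (M := ⊤) (chi.comp (bulletHom ι φ))
    (∑ i, (AddMonoidHom.mulLeft (map Ω ι (chi (φ.toAlgHom (X _ i))))).comp
      ((bulletHom ι φ).comp (pd i)))
    (fun n y hy => euler_mem_highDeg _ (bullet_mem_highDeg ι φ hy)) (fun n y hy => ?_)
    (fun γ m _ => ?_) (mem_coeffsIn_top r)
  · simpa [AddMonoidHom.finsetSum_apply, bulletHom_apply] using h
  · rw [AddMonoidHom.finsetSum_apply]
    refine sum_mem fun i _ => ?_
    change map Ω ι (chi (φ.toAlgHom (X _ i))) * bullet ι φ (pd i y) ∈ _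
    refine mul_mem_highDeg_of_coeff_zero ?_ fun e he =>
      coeff_bullet_eq_zero ι φ fun α hα => ?_
    · rw [TPS.coeff_map, coeff_euler, map_zero, zero_smul, map_zero]
    · rw [coeff_pd, hy, smul_zero]
      rw [_root_.map_add, Finsupp.degree_single]
      omega
  · rw [AddMonoidHom.finsetSum_apply]
    change chi (bullet ι φ (monomial _ γ m)) =
      ∑ i, map Ω ι (chi (φ.toAlgHom (X _ i))) * bullet ι φ (pd i (monomial _ γ m))
    rw [bullet_monomial, euler_mul, euler_monomial, map_zero, zero_smul, mul_zero, add_zero,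
      euler_map, chi_substMap_monomial, map_sum, Finset.sum_mul]
    refine Finset.sum_congr rfl fun i _ => ?_
    rw [monomial_eq_mul_const γ m, pd_mul_const, bullet_mul_const, map_mul, ← bullet_map, ← pd_map,
      TPS.map_monomial, map_one, mul_assoc]

end Bullet

/-! ### Stability of logarithmic derivatives under substitution. -/

section SubstLog

variable {k : Type u} [CommRing k] {A : Type v} [CommRing A] {p q : ℕ} {Δ : Coideal p}
  {Ω : Coideal q} {R : Type w} [Ring R] [Algebra k R]

open TPS

namespace TPS

theorem pd_mem_coeffsIn {M : Submodule k R} (i : Fin p) {x : TPS R (Coideal.all p)}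
    (hx : x ∈ coeffsIn _ M) : pd i x ∈ coeffsIn _ M := fun α => by
  rw [coeff_pd]
  exact M.nsmul_mem (hx _) _

theorem mul_mem_coeffsIn_of_map {M : Submodule k R} {ι : A →+* R} (h : ∀ a, ∀ x ∈ M, ι a * x ∈ M)
    (a : TPS A Δ) {x : TPS R Δ} (hx : x ∈ coeffsIn Δ M) : map Δ ι a * x ∈ coeffsIn Δ M := fun _ =>
  coeff_mul_of_forall _ x M.toAddSubgroup fun _ _ => by
    rw [TPS.coeff_map]
    exact h _ _ (hx _)

end TPS

/-- The truncation `A[[s]] → A[[s]]_Δ`, followed by a substitution map. -/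
noncomputable def SubstMap.precompTrunc (φ : SubstMap A Δ Ω) :
    SubstMap A (Coideal.all p) Ω where
  toAlgHom := φ.toAlgHom.comp (Ideal.Quotient.factorₐ A (I := truncIdeal A (Coideal.all p))
    (J := truncIdeal A Δ) fun _ hf α _ => hf α trivial)
  order_X i := φ.order_X i

theorem SubstMap.precompTrunc_monomial (φ : SubstMap A Δ Ω) (α : Fin p →₀ ℕ) (a : A) :
    φ.precompTrunc.toAlgHom (monomial _ α a) = φ.toAlgHom (monomial Δ α a) := rfl

/-- φ is defined modulo the monomials outside Δ, so the coefficients of an extension of s there do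
not matter. -/
theorem bullet_precompTrunc (ι : A →+* R) (φ : SubstMap A Δ Ω) {r : TPS R (Coideal.all p)}
    {s : TPS R Δ} (h : ∀ α ∈ Δ, coeff α r = coeff α s) :
    bullet ι φ.precompTrunc r = bullet ι φ s := by
  refine TPS.ext fun e he => ?_
  rw [coeff_bullet _ _ _ he, coeff_bullet _ _ _ he]
  refine Finset.sum_congr rfl fun α _ => ?_
  rw [SubstMap.precompTrunc_monomial]
  by_cases hα : α ∈ Δ
  · rw [h α hα]
  · rw [monomial_of_notMem hα, map_zero, TPS.coeff_zero, map_zero, zero_mul, zero_mul]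

/-- Solutions of `χ(U) = U ε` extend to all multi-indices. -/
theorem HasLogIn.exists_extension [Algebra ℚ k] {L : Submodule k R} {U : TPS R Δ}
    (hU : HasLogIn L U) :
    ∃ V : TPS R (Coideal.all p), HasLogIn L V ∧ ∀ α ∈ Δ, coeff α V = coeff α U := by
  obtain ⟨h0, ε, hε, hUε⟩ := hU
  have hε0 := coeff_zero_of_chi hUε h0
  -- Extension of ε by zero outside Δ. Truncating its solution solves the original equation, so it
  -- is U by uniqueness.
  set η : TPS R (Coideal.all p) := mk _ fun α => coeff α ε with hη
  have hηc : ∀ α, coeff α η = coeff α ε := fun α => coeff_mk (Coideal.mem_all α) _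
  obtain ⟨V, hV0, hV⟩ := exists_chi_eq_mul (k := k) (ε := η) (by rw [hηc, hε0])
  refine ⟨V, ⟨hV0, η, fun α => by rw [hηc]; exact hε α, hV⟩, fun α hα => ?_⟩
  have hW : mk Δ (fun α => coeff α V) = U := by
    refine chi_eq_mul_unique (k := k) (ε := ε) (TPS.ext fun β hβ => ?_) hUε hε0 ?_
    · have h := congrArg (coeff β) hV
      rw [coeff_euler, coeff_mul (Coideal.mem_all β)] at h
      rw [coeff_euler, coeff_mk hβ, coeff_mul hβ, h]
      refine Finset.sum_congr rfl fun c hc => ?_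
      rw [hηc, coeff_mk (Coideal.mem_of_le hβ (fst_le_of_mem hc))]
    · rw [coeff_mk Δ.zero_mem, hV0, h0]
  rw [← hW, coeff_mk hα]

/-- For l = U⁻¹∂_i(U), comparing χ∂_i(U) with ∂_iχ(U) gives χ(l) + l = [l, ε] + ∂_i(ε), which forces
the coefficients of l into L. -/
theorem HasLogIn.exists_pd_eq [Algebra ℚ k] {L : Submodule k R}
    (hL : ∀ m ∈ L, ∀ l ∈ L, m * l - l * m ∈ L) {U : TPS R (Coideal.all p)} (hU : HasLogIn L U)
    (i : Fin p) : ∃ l ∈ coeffsIn _ L, pd i U = U * l := by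
  obtain ⟨u, rfl⟩ := hU.isUnit
  obtain ⟨h0, ε, hε, hUε⟩ := hU
  refine ⟨↑u⁻¹ * pd i (u : TPS R (Coideal.all p)), ?_, by rw [Units.mul_inv_cancel_left]⟩
  generalize hl : ↑u⁻¹ * pd i (u : TPS R (Coideal.all p)) = l
  have hul : pd i (u : TPS R (Coideal.all p)) = u * l := by rw [← hl, Units.mul_inv_cancel_left]
  refine mem_coeffsIn_of_chi hL (ε := ε) (r := pd i ε) 1 ?_ hε (coeff_zero_of_chi hUε h0)
    (pd_mem_coeffsIn i hε) (Or.inl one_ne_zero)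
  have h := chi_pd i (u : TPS R (Coideal.all p))
  rw [hUε, pd_mul, hul, euler_mul, hUε] at h
  simp only [mul_assoc] at h
  rw [← mul_add, ← mul_add, ← mul_add, Units.mul_right_inj] at h
  rw [one_smul]
  have h2 : chi l + l = (ε * l + chi l + l) - ε * l := by abel
  rw [h2, h]
  abel

/-- The series with logarithmic derivative in `L` are stable under substitutions. -/
theorem HasLogIn.bullet [Algebra ℚ k] {L : Submodule k R}
    (hL : ∀ m ∈ L, ∀ l ∈ L, m * l - l * m ∈ L) {ι : A →+* R} (hA : ∀ a, ∀ l ∈ L, ι a * l ∈ L)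
    {U : TPS R Δ} (hU : HasLogIn L U) (φ : SubstMap A Δ Ω)
    (hconj : ∀ c : TPS A Ω, ∃ b : TPS A Ω,
      bullet ι φ U * map Ω ι b = map Ω ι c * bullet ι φ U) :
    HasLogIn L (bullet ι φ U) := by
  have h0 : coeff 0 (HSMod.bullet ι φ U) = 1 := by rw [coeff_zero_bullet, hU.1]
  refine ⟨h0, ?_⟩
  -- ∂_i needs coefficients just beyond Δ, so U is first extended to all multi-indices.
  obtain ⟨V, hV, hVU⟩ := hU.exists_extension
  rw [← bullet_precompTrunc ι φ hVU] at hconj h0 ⊢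
  generalize φ.precompTrunc = ψ at hconj h0 ⊢
  obtain ⟨u, hu⟩ := isUnit_of_coeff_zero h0
  -- These are the summands of the chain rule for χ(ψ•V); each must be ψ•V times a series with
  -- coefficients in L.
  have key : ∀ i : Fin p, ∃ t ∈ coeffsIn Ω L,
      map Ω ι (chi (ψ.toAlgHom (X _ i))) * HSMod.bullet ι ψ (pd i V) =
        HSMod.bullet ι ψ V * t := by
    intro i
    obtain ⟨l, hl, hVl⟩ := hV.exists_pd_eq hL i
    generalize chi (ψ.toAlgHom (X _ i)) = d
    refine ⟨↑u⁻¹ * (map Ω ι d * HSMod.bullet ι ψ (V * l)), ?_, by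
      rw [← hu, Units.mul_inv_cancel_left, hVl]⟩
    obtain ⟨f, hf⟩ : ∃ f : TPS R (Coideal.all p) →+ TPS R Ω, ∀ x,
        f x = ↑u⁻¹ * (map Ω ι d * HSMod.bullet ι ψ (V * x)) :=
      ⟨(AddMonoidHom.mulLeft (↑u⁻¹ : TPS R Ω)).comp ((AddMonoidHom.mulLeft (map Ω ι d)).comp
        ((bulletHom ι ψ).comp (AddMonoidHom.mulLeft V))), fun _ => rfl⟩
    rw [← hf]
    refine map_mem_coeffsIn (M := L) f (fun n y hy => ?_) (fun γ m hm => ?_) hl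
    · rw [hf]
      exact mul_mem_highDeg _ (mul_mem_highDeg _ (bullet_mem_highDeg ι ψ (mul_mem_highDeg _ hy)))
    rw [hf]
    have h1 : V * monomial _ γ m = map _ ι (monomial _ γ 1) * V * monomial _ 0 m := by
      rw [TPS.map_monomial, map_one, monomial_one_mul_comm, mul_assoc, ← monomial_eq_mul_const]
    -- The commutative factors stand on the left of ψ•V. `hconj` carries them to its right, where
    -- they multiply m ∈ L.
    obtain ⟨b, hb⟩ := hconj (d * ψ.toAlgHom (monomial _ γ 1))
    have h2 : map Ω ι d * (map Ω ι (ψ.toAlgHom (monomial _ γ 1)) * HSMod.bullet ι ψ V *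
        monomial Ω 0 m) = HSMod.bullet ι ψ V * (map Ω ι b * monomial Ω 0 m) := by
      rw [← mul_assoc (HSMod.bullet ι ψ V), hb, map_mul]
      simp only [mul_assoc]
    rw [h1, bullet_mul_const, bullet_map_mul, h2, ← hu, Units.inv_mul_cancel_left]
    exact mul_mem_coeffsIn_of_map hA b (monomial_mem_coeffsIn 0 hm)
  choose t ht htV using key
  refine ⟨∑ i, t i, sum_mem fun i _ => ht i, ?_⟩
  rw [chi_bullet, Finset.mul_sum]
  exact Finset.sum_congr rfl fun i _ => htV i

end SubstLog

/-! ### Hasse--Schmidt derivations and their logarithmic derivatives -/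

section HSLog

variable {k : Type u} {A : Type v} [CommRing k] [CommRing A] [Algebra k A] {p q : ℕ}
  {Δ : Coideal p} {Ω : Coideal q}

open TPS

/-- Applying r to x amounts to multiplying by the multiplication operators of x and evaluating at 1,
so properties of `tilde` come from ring identities over End_k(A). -/
theorem coeff_tilde_eq (α : Fin p →₀ ℕ) (r : TPS (Module.End k A) Δ) (x : TPS A Δ) :
    coeff α (tilde r x) = coeff α (r * map Δ (leftAct k A A : A →+* Module.End k A) x) 1 := by
  by_cases hα : α ∈ Δ
  · rw [coeff_tilde hα, coeff_mul hα, LinearMap.sum_apply]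
    refine Finset.sum_congr rfl fun c _ => ?_
    rw [TPS.coeff_map]
    change _ = coeff c.1 r (coeff c.2 x • (1 : A))
    rw [smul_eq_mul, mul_one]
  · rw [coeff_of_notMem hα, coeff_of_notMem hα]
    rfl

/-- The map `tilde r` as an additive map. -/
noncomputable def tildeHom (r : TPS (Module.End k A) Δ) : TPS A Δ →+ TPS A Δ :=
  AddMonoidHom.mk' (tilde r) fun x y => by
    refine TPS.ext fun α _ => ?_
    rw [coeff_add, coeff_tilde_eq, coeff_tilde_eq, coeff_tilde_eq, _root_.map_add, mul_add, coeff_add]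
    rfl

theorem tildeHom_apply (r : TPS (Module.End k A) Δ) (x : TPS A Δ) :
    tildeHom r x = tilde r x := rfl

theorem tilde_mem_highDeg (r : TPS (Module.End k A) Δ) {n : ℕ} {x : TPS A Δ}
    (hx : x ∈ highDeg A Δ n) : tilde r x ∈ highDeg A Δ n := fun α hα => by
  rw [coeff_tilde_eq, mul_mem_highDeg r (map_mem_highDeg _ hx) α hα]
  rfl

theorem tilde_monomial (r : TPS (Module.End k A) Δ) (γ : Fin p →₀ ℕ) (a : A) :
    tilde r (monomial Δ γ a) = monomial Δ γ 1 * tilde r (const Δ a) := by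
  refine TPS.ext fun α hα => ?_
  rw [coeff_tilde_eq, monomial_eq_mul_const γ a, map_mul, TPS.map_monomial,
    map_one (leftAct k A A : A →+* Module.End k A), ← mul_assoc, ← monomial_one_mul_comm, mul_assoc, coeff_monomial_mul hα, coeff_monomial_mul hα]
  split_ifs
  · rw [coeff_tilde_eq, one_mul, one_mul]
    rfl
  · rfl

theorem chi_tilde (r : TPS (Module.End k A) Δ) (x : TPS A Δ) :
    chi (tilde r x) = tilde (chi r) x + tilde r (chi x) := by
  refine TPS.ext fun α _ => ?_
  rw [coeff_add, coeff_euler, coeff_tilde_eq, coeff_tilde_eq, coeff_tilde_eq, ← euler_map,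
    ← LinearMap.add_apply, ← coeff_add, ← euler_mul, coeff_euler]
  rfl

theorem map_leftAct_injective {x y : TPS A Δ}
    (h : map Δ (leftAct k A A : A →+* Module.End k A) x =
      map Δ (leftAct k A A : A →+* Module.End k A) y) : x = y := by
  refine TPS.ext fun α _ => ?_
  have h1 := congrArg (fun z : TPS (Module.End k A) Δ => coeff α z 1) h
  rw [TPS.coeff_map, TPS.coeff_map] at h1
  change coeff α x • (1 : A) = coeff α y • (1 : A) at h1
  simpa using h1

theorem HS.mul_const (D : HS k A Δ) (a : A) :
    D.1.val * monomial Δ 0 (leftAct k A A a) =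
      map Δ (leftAct k A A : A →+* Module.End k A) (tilde D.1.val (const Δ a)) * D.1.val := by
  refine TPS.ext fun α hα => ?_
  rw [coeff_mul_const, coeff_mul hα]
  refine LinearMap.ext fun x => ?_
  rw [LinearMap.sum_apply]
  refine (D.2.coeff_mul α hα a x).trans (Finset.sum_congr rfl fun c hc => ?_)
  rw [TPS.coeff_map, coeff_tilde_const (Coideal.mem_of_le hα (fst_le_of_mem hc))]
  rfl

theorem HS.coeff_zero (D : HS k A Δ) : coeff 0 D.1.val = 1 := D.2.coeff_zero

theorem HS.tilde_tilde_inv (D : HS k A Δ) (x : TPS A Δ) :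
    tilde D.1.val (tilde D⁻¹.1.val x) = x := by
  rw [← tilde_mul]
  change tilde ((D * D⁻¹ : HS k A Δ).1.val) x = x
  rw [mul_inv_cancel]
  exact tilde_one x

theorem HS.tilde_inv_tilde (D : HS k A Δ) (x : TPS A Δ) :
    tilde D⁻¹.1.val (tilde D.1.val x) = x := by
  rw [← tilde_mul]
  change tilde ((D⁻¹ * D : HS k A Δ).1.val) x = x
  rw [inv_mul_cancel]
  exact tilde_one x

/-- The coefficients of the logarithmic derivative of a Hasse--Schmidt derivation are
derivations. -/
theorem HS.exists_derivation (D : HS k A Δ) :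
    ∃ δ : (Fin p →₀ ℕ) → Derivation k A A,
      chi D.1.val = D.1.val * TPS.mk Δ fun α => ((δ α : A →ₗ[k] A) : Module.End k A) := by
  set ε : TPS (Module.End k A) Δ := D⁻¹.1.val * chi D.1.val with hε
  -- As χ kills constants, ε acts on them as D⁻¹χD, a derivation conjugated by a ring automorphism.
  have h1 : ∀ a, tilde ε (const Δ a) = tilde D⁻¹.1.val (chi (tilde D.1.val (const Δ a))) := by
    intro a
    have h2 : chi (const Δ a) = 0 := by rw [const, euler_monomial, map_zero, zero_smul]
    rw [chi_tilde, h2, ← tildeHom_apply D.1.val, map_zero, add_zero, hε, tilde_mul]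
  have h3 : ∀ α a b, coeff α ε (a * b) = a • coeff α ε b + b • coeff α ε a := by
    intro α a b
    by_cases hα : α ∈ Δ
    · rw [← coeff_tilde_const hα, h1, const_mul, D.2.tilde_mul, euler_mul, ← tildeHom_apply,
        _root_.map_add, tildeHom_apply, tildeHom_apply, D⁻¹.2.tilde_mul, D⁻¹.2.tilde_mul,
        HS.tilde_inv_tilde D, HS.tilde_inv_tilde D, ← h1, ← h1, coeff_add, const, const,
        coeff_mul_const, coeff_const_mul, ← const, ← const, coeff_tilde_const hα,
        coeff_tilde_const hα, smul_eq_mul, smul_eq_mul, mul_comm b, add_comm]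
    · rw [coeff_of_notMem hα]
      simp
  refine ⟨fun α => Derivation.mk' (coeff α ε) (h3 α), ?_⟩
  have h4 : (TPS.mk Δ fun α => ((Derivation.mk' (coeff α ε) (h3 α) : Derivation k A A) : A →ₗ[k] A)) =
      ε := TPS.ext fun α hα => by
    rw [coeff_mk hα]
    rfl
  rw [h4, hε, ← mul_assoc]
  change _ = (D * D⁻¹ : HS k A Δ).1.val * _
  rw [mul_inv_cancel]
  exact (one_mul _).symm

/-- The logarithmic derivative of a Hasse--Schmidt derivation. -/
noncomputable def HS.log (D : HS k A Δ) : (Fin p →₀ ℕ) → Derivation k A A :=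
  (HS.exists_derivation D).choose

theorem HS.chi_eq (D : HS k A Δ) :
    chi D.1.val = D.1.val * TPS.mk Δ fun α => ((HS.log D α : A →ₗ[k] A) : Module.End k A) :=
  (HS.exists_derivation D).choose_spec

theorem SubstMap.tilde_act (φ : SubstMap A Δ Ω) (D : HS k A Δ) (x : A) :
    tilde (φ.act D).1.val (const Ω x) = φ.toAlgHom (tilde D.1.val (const Δ x)) := by
  refine TPS.ext fun e he => ?_
  rw [coeff_tilde_const he, φ.coeff_apply he]
  change coeff e (bullet (leftAct k A A : A →+* Module.End k A) φ D.1.val) x = _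
  rw [coeff_bullet _ _ _ he, LinearMap.sum_apply]
  refine Finset.sum_congr rfl fun α _ => ?_
  by_cases hα : α ∈ Δ
  · rw [coeff_tilde_const hα]
    rfl
  · rw [TPS.coeff_of_notMem hα, TPS.coeff_of_notMem hα, mul_zero, mul_zero]
    rfl

end HSLog

/-! ### The HS-structure attached to an LR-admissible map -/

section Lift

variable {k : Type u} {A : Type v} [CommRing k] [CommRing A] [Algebra k A] {p q : ℕ}
  {Δ : Coideal p} {Ω : Coideal q}
variable {R : Type w} [Ring R] [Algebra k R] {ι : A →ₐ[k] R}

open TPS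

namespace LRAdmissible

variable (nabla : LRAdmissible ι)

theorem map_smul_base (c : k) (δ : Derivation k A A) :
    nabla.toFun (c • δ) = c • nabla.toFun δ := by
  rw [← algebraMap_smul A c δ, nabla.map_smul, AlgHom.commutes, Algebra.smul_def]

theorem map_zero : nabla.toFun 0 = 0 := by
  have h := nabla.map_smul_base 0 0
  rwa [zero_smul, zero_smul] at h

/-- The graph of an LR-admissible map. -/
def graph : Submodule k (Module.End k A × R) where
  carrier := {x | ∃ δ : Derivation k A A, x = ((δ : A →ₗ[k] A), nabla.toFun δ)}
  add_mem' := by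
    rintro _ _ ⟨δ, rfl⟩ ⟨δ', rfl⟩
    exact ⟨δ + δ', by rw [nabla.map_add]; rfl⟩
  zero_mem' := ⟨0, by rw [nabla.map_zero]; rfl⟩
  smul_mem' := by
    rintro c _ ⟨δ, rfl⟩
    exact ⟨c • δ, by rw [nabla.map_smul_base]; rfl⟩

/-- The `k`-algebra map `A → End_k(A) × R`. -/
def act (ι : A →ₐ[k] R) : A →ₐ[k] Module.End k A × R := (leftAct k A A).prod ι

theorem act_apply (a : A) : act ι a = (leftAct k A A a, ι a) := rfl

theorem mem_graph (δ : Derivation k A A) :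
    (((δ : A →ₗ[k] A) : Module.End k A), nabla.toFun δ) ∈ nabla.graph := ⟨δ, rfl⟩

/-- The integrability of ∇ enters the construction here. -/
theorem lie_mem_graph : ∀ x ∈ nabla.graph, ∀ y ∈ nabla.graph, x * y - y * x ∈ nabla.graph := by
  rintro _ ⟨δ, rfl⟩ _ ⟨δ', rfl⟩
  refine ⟨⁅δ, δ'⁆, ?_⟩
  rw [nabla.map_lie]
  rfl

theorem act_mul_mem_graph (a : A) : ∀ x ∈ nabla.graph, act ι a * x ∈ nabla.graph := by
  rintro _ ⟨δ, rfl⟩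
  refine ⟨a • δ, ?_⟩
  rw [nabla.map_smul]
  rfl

/-- [a, δ] = -δ(a) in End_k(A), and [a, ∇(δ)] = -δ(a) in R by the Leibniz rule for ∇. -/
theorem lie_mem_range : ∀ x ∈ LinearMap.range (act ι).toLinearMap, ∀ y ∈ nabla.graph,
    x * y - y * x ∈ LinearMap.range (act ι).toLinearMap := by
  rintro _ ⟨a, rfl⟩ _ ⟨δ, rfl⟩
  refine ⟨-(δ a), ?_⟩
  rw [AlgHom.toLinearMap_apply, AlgHom.toLinearMap_apply, act_apply, act_apply, Prod.mk_mul_mk,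
    Prod.mk_mul_mk, Prod.mk_sub_mk, nabla.leibniz, _root_.map_neg, _root_.map_neg]
  refine Prod.ext ?_ ?_
  · refine LinearMap.ext fun x => ?_
    change -(δ a • x) = a • δ x - δ (a • x)
    simp only [smul_eq_mul, Derivation.leibniz]
    ring
  · dsimp only
    abel

theorem eq_of_mem_graph {x y : Module.End k A × R} (hx : x ∈ nabla.graph) (hy : y ∈ nabla.graph)
    (h : x.1 = y.1) : x = y := by
  obtain ⟨δ, rfl⟩ := hx
  obtain ⟨δ', rfl⟩ := hy
  have : δ = δ' := Derivation.ext fun a => LinearMap.congr_fun h a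
  rw [this]

variable [Algebra ℚ k]

/-- The first component of U gives that of its logarithmic derivative, hence all of the latter by
`eq_of_mem_graph`, hence U. -/
theorem hasLogIn_unique {U V : TPS (Module.End k A × R) Δ} (hU : HasLogIn nabla.graph U)
    (hV : HasLogIn nabla.graph V)
    (h : map Δ (RingHom.fst (Module.End k A) R) U = map Δ (RingHom.fst (Module.End k A) R) V) :
    U = V := by
  obtain ⟨hU0, ε, hε, hUε⟩ := hU
  obtain ⟨hV0, η, hη, hVη⟩ := hV
  have h1 : map Δ (RingHom.fst (Module.End k A) R) ε =
      map Δ (RingHom.fst (Module.End k A) R) η := by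
    have h2 : IsUnit (map Δ (RingHom.fst (Module.End k A) R) U) :=
      (isUnit_of_coeff_zero hU0).map _
    have h3 := congrArg chi h
    rw [euler_map, euler_map, hUε, hVη, map_mul, map_mul, ← h] at h3
    exact h2.mul_left_cancel h3
  have h4 : ε = η := TPS.ext fun α _ => nabla.eq_of_mem_graph (hε α) (hη α) (by
    have h5 := congrArg (coeff α) h1
    rwa [TPS.coeff_map, TPS.coeff_map] at h5)
  subst h4
  exact chi_eq_mul_unique (k := k) hUε hVη (coeff_zero_of_chi hUε hU0) (hU0.trans hV0.symm)

/-- Integrate the pairs (ε_α, ∇(ε_α)), where ε is the logarithmic derivative of D; by uniqueness the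
first component of the solution is D. -/
theorem exists_lift (D : HS k A Δ) : ∃ U : TPS (Module.End k A × R) Δ,
    HasLogIn nabla.graph U ∧ map Δ (RingHom.fst (Module.End k A) R) U = D.1.val ∧
    chi U = U * TPS.mk Δ fun α => (((HS.log D α : A →ₗ[k] A) : Module.End k A),
      nabla.toFun (HS.log D α)) := by
  set ε : TPS (Module.End k A × R) Δ :=
    TPS.mk Δ fun α => (((HS.log D α : A →ₗ[k] A) : Module.End k A), nabla.toFun (HS.log D α)) with hε
  have hD0 := coeff_zero_of_chi (HS.chi_eq D) (HS.coeff_zero D)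
  have hεL : ε ∈ coeffsIn Δ nabla.graph := fun α => by
    by_cases hα : α ∈ Δ
    · rw [hε, coeff_mk hα]
      exact nabla.mem_graph _
    · rw [coeff_of_notMem hα]
      exact zero_mem _
  have hfst : map Δ (RingHom.fst (Module.End k A) R) ε =
      TPS.mk Δ fun α => ((HS.log D α : A →ₗ[k] A) : Module.End k A) := TPS.ext fun α hα => by
    rw [TPS.coeff_map, hε, coeff_mk hα, coeff_mk hα]
    rfl
  have hε0 : coeff 0 ε = 0 := by
    refine nabla.eq_of_mem_graph (hεL 0) (zero_mem _) ?_
    rw [← hfst, TPS.coeff_map] at hD0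
    exact hD0
  obtain ⟨U, hU0, hU⟩ := exists_chi_eq_mul (k := k) hε0
  refine ⟨U, ⟨hU0, ε, hεL, hU⟩, ?_, hU⟩
  refine chi_eq_mul_unique (k := k) (ε := map Δ (RingHom.fst (Module.End k A) R) ε) ?_ ?_ ?_ ?_
  · rw [euler_map, hU, map_mul]
  · rw [hfst, HS.chi_eq D]
  · rw [hfst, hD0]
  · rw [TPS.coeff_map, hU0, HS.coeff_zero D, map_one]

/-- The lift of a Hasse--Schmidt derivation to the graph of an LR-admissible map. -/
noncomputable def lift (D : HS k A Δ) : TPS (Module.End k A × R) Δ := (nabla.exists_lift D).choose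

theorem hasLogIn_lift (D : HS k A Δ) : HasLogIn nabla.graph (nabla.lift D) :=
  (nabla.exists_lift D).choose_spec.1

theorem map_fst_lift (D : HS k A Δ) :
    map Δ (RingHom.fst (Module.End k A) R) (nabla.lift D) = D.1.val :=
  (nabla.exists_lift D).choose_spec.2.1

theorem lift_mul (D E : HS k A Δ) : nabla.lift (D * E) = nabla.lift D * nabla.lift E := by
  refine nabla.hasLogIn_unique (nabla.hasLogIn_lift _)
    ((nabla.hasLogIn_lift D).mul nabla.lie_mem_graph (nabla.hasLogIn_lift E)) ?_
  rw [map_mul, nabla.map_fst_lift, nabla.map_fst_lift, nabla.map_fst_lift]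
  rfl

/-- Conjugating the series D(a) by the lift gives a series with coefficients in the image of A. Its
first component is a by the Leibniz rule of D, and elements of A act faithfully on A. -/
theorem lift_mul_const (D : HS k A Δ) (a : A) :
    nabla.lift D * monomial Δ 0 (act ι a) =
      map Δ (act ι : A →+* Module.End k A × R) (tilde D.1.val (const Δ a)) * nabla.lift D := by
  have hx : map Δ (act ι : A →+* Module.End k A × R) (tilde D.1.val (const Δ a)) ∈
      coeffsIn Δ (LinearMap.range (act ι).toLinearMap) := fun α => by
    rw [TPS.coeff_map]
    exact ⟨_, rfl⟩
  obtain ⟨y, hy, hUy⟩ := (nabla.hasLogIn_lift D).exists_mul_eq nabla.lie_mem_range hx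
  choose b hb using hy
  have hyb : y = map Δ (act ι : A →+* Module.End k A × R) (TPS.mk Δ b) := TPS.ext fun α hα => by
    rw [TPS.coeff_map, coeff_mk hα, ← hb]
    rfl
  have hm : ∀ z : TPS A Δ, map Δ (RingHom.fst (Module.End k A) R)
      (map Δ (act ι : A →+* Module.End k A × R) z) =
      map Δ (leftAct k A A : A →+* Module.End k A) z := fun z => TPS.ext fun α _ => by
    rw [TPS.coeff_map, TPS.coeff_map, TPS.coeff_map]
    rfl
  have h1 := congrArg (map Δ (RingHom.fst (Module.End k A) R)) hUy
  rw [map_mul, map_mul, nabla.map_fst_lift, hyb, hm, hm, ← HS.mul_const D, Units.mul_right_inj] at h1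
  have h2 : TPS.mk Δ b = const Δ a := by
    refine map_leftAct_injective (k := k) (h1.trans ?_)
    rw [const, TPS.map_monomial]
    rfl
  rw [← hUy, hyb, h2, const, TPS.map_monomial]
  rfl

/-- Both sides have first component φ•D and logarithmic derivative in the graph. -/
theorem lift_act (φ : SubstMap A Δ Ω) (D : HS k A Δ) :
    nabla.lift (φ.act D) = bullet (act ι : A →+* Module.End k A × R) φ (nabla.lift D) := by
  set U' := bullet (act ι : A →+* Module.End k A × R) φ (nabla.lift D) with hU'
  have hconst : ∀ a : A, U' * monomial Ω 0 (act ι a) =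
      map Ω (act ι : A →+* Module.End k A × R) (tilde (φ.act D).1.val (const Ω a)) * U' := by
    intro a
    rw [hU', ← bullet_mul_const, nabla.lift_mul_const, bullet_map_mul, φ.tilde_act]
  have hconj : ∀ x : TPS A Ω, U' * map Ω (act ι : A →+* Module.End k A × R) x =
      map Ω (act ι : A →+* Module.End k A × R) (tilde (φ.act D).1.val x) * U' := by
    intro x
    refine addHom_ext_of_monomial (k := ℤ) (M := ⊤)
      ((AddMonoidHom.mulLeft U').comp (map Ω (act ι : A →+* Module.End k A × R)).toAddMonoidHom)
      ((AddMonoidHom.mulRight U').comp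
        ((map Ω (act ι : A →+* Module.End k A × R)).toAddMonoidHom.comp
          (tildeHom (φ.act D).1.val)))
      (fun n y hy => ?_) (fun n y hy => ?_) (fun γ a _ => ?_) (mem_coeffsIn_top x)
    · change U' * map Ω (act ι : A →+* Module.End k A × R) y ∈ _
      exact mul_mem_highDeg _ (map_mem_highDeg _ hy)
    · change map Ω (act ι : A →+* Module.End k A × R) (tilde (φ.act D).1.val y) * U' ∈ _
      exact mul_mem_highDeg' (map_mem_highDeg _ (tilde_mem_highDeg _ hy)) _
    change U' * map Ω (act ι : A →+* Module.End k A × R) (monomial Ω γ a) =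
      map Ω (act ι : A →+* Module.End k A × R) (tilde (φ.act D).1.val (monomial Ω γ a)) * U'
    rw [tilde_monomial, map_mul, mul_assoc, ← hconst, TPS.map_monomial, TPS.map_monomial, map_one,
      ← mul_assoc, monomial_one_mul_comm, mul_assoc, ← monomial_eq_mul_const]
    rfl
  refine nabla.hasLogIn_unique (nabla.hasLogIn_lift _) ?_ ?_
  · refine (nabla.hasLogIn_lift D).bullet nabla.lie_mem_graph nabla.act_mul_mem_graph φ fun c => ?_
    -- Moving c across φ•U applies the inverse automorphism (φ•D)⁻¹ to it.
    exact ⟨tilde (φ.act D)⁻¹.1.val c, (hconj _).trans (by rw [HS.tilde_tilde_inv]; rfl)⟩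
  · rw [nabla.map_fst_lift, hU', map_bullet, nabla.map_fst_lift]
    rfl

theorem map_snd_lift_mem (D : HS k A Δ) :
    coeff 0 (map Δ (RingHom.snd (Module.End k A) R) (nabla.lift D)) = 1 := by
  rw [TPS.coeff_map, (nabla.hasLogIn_lift D).1, map_one]

/-- The HS-structure attached to an LR-admissible map. -/
noncomputable def toHSStructure : HSStructure ι where
  toHom Δ := MonoidHom.mk'
    (fun D => ⟨(isUnit_of_coeff_zero (nabla.map_snd_lift_mem D)).unit, nabla.map_snd_lift_mem D⟩)
    fun D E => by
      refine Subtype.ext (Units.ext ?_)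
      change map _ _ (nabla.lift (D * E)) = map _ _ (nabla.lift D) * map _ _ (nabla.lift E)
      rw [nabla.lift_mul, map_mul]
  leibniz Δ D a α hα := by
    have h : coeff α (map Δ (RingHom.snd (Module.End k A) R)
        (nabla.lift D * monomial Δ 0 (act ι a))) = coeff α (map Δ (RingHom.snd (Module.End k A) R)
        (map Δ (act ι : A →+* Module.End k A × R) (tilde D.1.val (const Δ a)) * nabla.lift D)) := by
      rw [nabla.lift_mul_const]
    rw [map_mul, map_mul, TPS.map_monomial, coeff_mul_const, coeff_mul hα] at h
    refine h.trans (Finset.sum_congr rfl fun c hc => ?_)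
    rw [TPS.coeff_map, TPS.coeff_map,
      coeff_tilde_const (Coideal.mem_of_le hα (fst_le_of_mem hc))]
    rfl
  subst φ D := by
    change map _ _ (nabla.lift (φ.act D)) = bullet _ _ (map _ _ (nabla.lift D))
    rw [nabla.lift_act, map_bullet]
    rfl

theorem toHSStructure_apply (D : HS k A Δ) : (nabla.toHSStructure.toHom Δ D).1.val =
    map Δ (RingHom.snd (Module.End k A) R) (nabla.lift D) := rfl

theorem chi_toHSStructure (D : HS k A Δ) :
    chi (nabla.toHSStructure.toHom Δ D).1.val =
      (nabla.toHSStructure.toHom Δ D).1.val * TPS.mk Δ fun α => nabla.toFun (HS.log D α) := by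
  rw [toHSStructure_apply, euler_map, lift, (nabla.exists_lift D).choose_spec.2.2, map_mul]
  congr 1

end LRAdmissible

end Lift

/-! ### Construction of substitution maps -/

section Construction

variable {A : Type v} [CommRing A] {p q : ℕ} {Δ : Coideal p} {Ω : Coideal q}
variable {R : Type w} [Ring R]

open TPS

/-- A multiplicative family `g_α` vanishing outside `Δ` defines a substitution map `s^α ↦ g_α`. -/
theorem exists_substMap (g : (Fin p →₀ ℕ) → TPS A Ω) (hg0 : g 0 = 1)
    (hg : ∀ α β, g (α + β) = g α * g β) (hgX : ∀ i, coeff 0 (g (Finsupp.single i 1)) = 0)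
    (hgΔ : ∀ α, α ∉ Δ → g α = 0) :
    ∃ φ : SubstMap A Δ Ω, ∀ α, φ.toAlgHom (monomial Δ α 1) = g α := by
  choose a ha using fun i : Fin p => Ideal.Quotient.mk_surjective (g (Finsupp.single i 1))
  have hprod : ∀ α : Fin p →₀ ℕ,
      Ideal.Quotient.mk (truncIdeal A Ω) (α.prod fun i n => a i ^ n) = g α := by
    intro α
    induction α using Finsupp.induction_linear with
    | zero => rw [Finsupp.prod_zero_index, map_one, hg0]
    | add α β hα hβ =>
      rw [Finsupp.prod_add_index' (fun _ => pow_zero _) (fun _ _ _ => pow_add _ _ _), map_mul, hα,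
        hβ, hg]
    | single i n =>
      rw [Finsupp.prod_single_index (h := fun i n => a i ^ n) (pow_zero _), map_pow, ha]
      induction n with
      | zero => rw [pow_zero, Finsupp.single_zero, hg0]
      | succ n ih => rw [pow_succ, ih, Finsupp.single_add, hg]
  have hs : MvPowerSeries.HasSubst a := MvPowerSeries.hasSubst_of_constantCoeff_zero fun i => by
    rw [← MvPowerSeries.coeff_zero_eq_constantCoeff_apply, ← coeff_mk' Ω.zero_mem, ha, hgX]
  have hmon : ∀ α : Fin p →₀ ℕ, Ideal.Quotient.mk (truncIdeal A Ω)
      (MvPowerSeries.substAlgHom (R := A) hs (MvPowerSeries.monomial α 1)) = g α := by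
    intro α
    rw [MvPowerSeries.substAlgHom_monomial, map_one, one_mul, hprod]
  -- Term by term, either f has no coefficient at α, or α ∉ Δ and s^α goes to g_α = 0.
  have hker : ∀ f ∈ truncIdeal A Δ, (Ideal.Quotient.mkₐ A (truncIdeal A Ω)).comp
      (MvPowerSeries.substAlgHom (R := A) hs) f = 0 := by
    intro f hf
    rw [AlgHom.comp_apply, Ideal.Quotient.mkₐ_eq_mk, Ideal.Quotient.eq_zero_iff_mem]
    intro e he
    rw [MvPowerSeries.substAlgHom_apply, MvPowerSeries.coeff_subst hs]
    refine finsum_eq_zero_of_forall_eq_zero fun α => ?_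
    by_cases hα : α ∈ Δ
    · rw [hf α hα, zero_smul]
    · rw [← coeff_mk' he, hprod, hgΔ α hα, TPS.coeff_zero, smul_zero]
  refine ⟨⟨Ideal.Quotient.liftₐ (truncIdeal A Δ) _ hker, fun i => ?_⟩, hmon⟩
  exact (congrArg (coeff 0) (hmon (Finsupp.single i 1))).trans (hgX i)

theorem Coideal.mem_below {α β : Fin p →₀ ℕ} : β ∈ Coideal.below α ↔ β ≤ α := Iff.rfl

theorem Coideal.single_mem_one : Finsupp.single 0 1 ∈ Coideal.one :=
  le_refl (Finsupp.single (0 : Fin 1) 1)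

theorem Coideal.eq_of_mem_one {α : Fin 1 →₀ ℕ} (hα : α ∈ Coideal.one) :
    α = 0 ∨ α = Finsupp.single 0 1 := by
  have h : α 0 ≤ 1 := by simpa using (show α ≤ Finsupp.single 0 1 from hα) 0
  rcases Nat.le_one_iff_eq_zero_or_eq_one.mp h with h | h
  · left; ext; simpa using h
  · right; ext; simpa using h

theorem single_zero_one_ne_zero : Finsupp.single (0 : Fin 1) 1 ≠ 0 := by simp

/-- The substitution `s ↦ x`, where `x² = 0`. -/
theorem exists_substMap_one {x : TPS A Ω} (hx0 : coeff 0 x = 0) (hx : x * x = 0) :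
    ∃ φ : SubstMap A Coideal.one Ω, φ.toAlgHom (monomial _ (Finsupp.single 0 1) 1) = x := by
  have hX : ∀ i : Fin 1, coeff 0 (x ^ Finsupp.single i 1 (0 : Fin 1)) = 0 := fun i => by
    rw [Subsingleton.elim i 0, Finsupp.single_eq_same, pow_one, hx0]
  have hΔ : ∀ α : Fin 1 →₀ ℕ, α ∉ Coideal.one → x ^ α 0 = 0 := fun α hα => by
    have h2 : 2 ≤ α 0 := by
      by_contra h
      refine hα fun i => ?_
      rw [Subsingleton.elim i 0, Finsupp.single_eq_same]
      omega
    exact pow_eq_zero_of_le h2 (by rw [pow_two, hx])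
  obtain ⟨φ, hφ⟩ := exists_substMap (fun α => x ^ α 0) (pow_zero x)
    (fun α β => pow_add x _ _) hX hΔ
  refine ⟨φ, ?_⟩
  rw [hφ, Finsupp.single_eq_same, pow_one]

theorem bullet_one (ι : A →+* R) (φ : SubstMap A Δ Ω) : bullet ι φ 1 = 1 := by
  rw [← map_one (map Δ ι), bullet_map, map_one, map_one]

theorem bullet_one_add_monomial (ι : A →+* R) (φ : SubstMap A Δ Ω) (α : Fin p →₀ ℕ) (r : R) :
    bullet ι φ (1 + monomial Δ α r) =
      1 + map Ω ι (φ.toAlgHom (monomial Δ α 1)) * monomial Ω 0 r := by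
  rw [← bulletHom_apply, _root_.map_add, bulletHom_apply, bulletHom_apply, bullet_one,
    bullet_monomial]

end Construction

/-! ### Substitutions over dual numbers: `Finsupp.cons j β` is the exponent of t^j s^β. -/

section Infinitesimal

variable {A : Type v} [CommRing A] {p : ℕ} {Δ : Coideal p}
variable {R : Type w} [Ring R]

open TPS

theorem cons_add_cons (i j : ℕ) (α β : Fin p →₀ ℕ) :
    Finsupp.cons i α + Finsupp.cons j β = Finsupp.cons (i + j) (α + β) := by
  ext l
  refine Fin.cases ?_ (fun l => ?_) l <;> simp

theorem cons_le_cons {i j : ℕ} {α β : Fin p →₀ ℕ} :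
    Finsupp.cons i α ≤ Finsupp.cons j β ↔ i ≤ j ∧ α ≤ β := by
  constructor
  · intro h
    exact ⟨by simpa using h 0, fun l => by simpa using h l.succ⟩
  · rintro ⟨h1, h2⟩ l
    refine Fin.cases ?_ (fun l => ?_) l
    · simpa using h1
    · simpa using h2 l

theorem cons_sub_cons (i j : ℕ) (α β : Fin p →₀ ℕ) :
    Finsupp.cons i α - Finsupp.cons j β = Finsupp.cons (i - j) (α - β) := by
  ext l
  refine Fin.cases ?_ (fun l => ?_) l <;> simp

theorem cons_inj {i j : ℕ} {α β : Fin p →₀ ℕ} :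
    Finsupp.cons i α = Finsupp.cons j β ↔ i = j ∧ α = β :=
  Finsupp.cons_injective2.eq_iff

theorem degree_cons (i : ℕ) (α : Fin p →₀ ℕ) :
    (Finsupp.cons i α).degree = i + α.degree := by
  rw [Finsupp.degree_eq_sum, Finsupp.degree_eq_sum, Fin.sum_univ_succ]
  simp

/-- The co-ideal of the monomials `s^β t^j` with `β ≤ α` and `j ≤ 1`. -/
noncomputable abbrev Coideal.dual (α : Fin p →₀ ℕ) : Coideal (p + 1) :=
  Coideal.below (Finsupp.cons 1 α)

theorem Coideal.cons_mem_dual {α β : Fin p →₀ ℕ} {j : ℕ} :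
    Finsupp.cons j β ∈ Coideal.dual α ↔ j ≤ 1 ∧ β ≤ α := cons_le_cons

/-- The substitution `s_i ↦ s_i`. -/
theorem exists_substMap_incl {α : Fin p →₀ ℕ} (hα : α ∈ Δ) :
    ∃ φ : SubstMap A Δ (Coideal.dual α), ∀ β,
      φ.toAlgHom (monomial Δ β 1) = monomial _ (Finsupp.cons 0 β) 1 := by
  refine exists_substMap (fun β => monomial _ (Finsupp.cons 0 β) 1) ?_ ?_ ?_ ?_
  · rw [Finsupp.cons_zero_zero, TPS.monomial_zero_one]
  · intro β γ
    rw [monomial_mul_monomial, one_mul, cons_add_cons]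
  · intro i
    rw [coeff_monomial (Coideal.zero_mem _), if_neg]
    rw [Finsupp.cons_zero_single_eq_single_succ]
    exact (Finsupp.single_ne_zero.mpr one_ne_zero).symm
  · intro β hβ
    refine monomial_of_notMem (fun h => hβ ?_) _
    exact Coideal.mem_of_le hα (Coideal.cons_mem_dual.mp h).2

/-- The substitution `s_i ↦ s_i (1 + t)`. -/
theorem exists_substMap_euler {α : Fin p →₀ ℕ} (hα : α ∈ Δ) :
    ∃ φ : SubstMap A Δ (Coideal.dual α), ∀ β, φ.toAlgHom (monomial Δ β 1) =
      monomial _ (Finsupp.cons 0 β) 1 + monomial _ (Finsupp.cons 1 β) (β.degree : A) := by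
  -- Modulo t², s^β(1 + t)^|β| is s^β + |β| s^β t.
  refine exists_substMap (fun β => monomial _ (Finsupp.cons 0 β) 1 +
    monomial _ (Finsupp.cons 1 β) (β.degree : A)) ?_ ?_ ?_ ?_
  · rw [Finsupp.cons_zero_zero, TPS.monomial_zero_one, map_zero, Nat.cast_zero, TPS.monomial_zero,
      add_zero]
  · intro β γ
    rw [add_mul, mul_add, mul_add, monomial_mul_monomial, monomial_mul_monomial,
      monomial_mul_monomial, monomial_mul_monomial, cons_add_cons, cons_add_cons, cons_add_cons,
      cons_add_cons, monomial_of_notMem (α := Finsupp.cons (1 + 1) (β + γ)), _root_.map_add,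
      Nat.cast_add, TPS.monomial_add]
    · simp only [mul_one, one_mul, add_zero, zero_add]
      abel
    · intro h
      exact absurd (Coideal.cons_mem_dual.mp h).1 (by norm_num)
  · intro i
    rw [coeff_add, coeff_monomial (Coideal.zero_mem _), coeff_monomial (Coideal.zero_mem _),
      if_neg, if_neg, add_zero]
    · exact (Finsupp.cons_ne_zero_of_left one_ne_zero).symm
    · exact (Finsupp.cons_ne_zero_of_right (Finsupp.single_ne_zero.mpr one_ne_zero)).symm
  · intro β hβ
    rw [monomial_of_notMem, monomial_of_notMem, add_zero] <;>
    exact fun h => hβ (Coideal.mem_of_le hα (Coideal.cons_mem_dual.mp h).2)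

variable {α : Fin p →₀ ℕ} (ι : A →+* R)

theorem coeff_bullet_incl {φ : SubstMap A Δ (Coideal.dual α)}
    (hφ : ∀ β, φ.toAlgHom (monomial Δ β 1) = monomial _ (Finsupp.cons 0 β) 1) (r : TPS R Δ)
    {j : ℕ} {β : Fin p →₀ ℕ} (hj : j ≤ 1) (hβ : β ≤ α) :
    coeff (Finsupp.cons j β) (bullet ι φ r) = if j = 0 then coeff β r else 0 := by
  have he : Finsupp.cons j β ∈ Coideal.dual α := Coideal.cons_mem_dual.mpr ⟨hj, hβ⟩
  rw [coeff_bullet _ _ _ he]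
  simp only [hφ, coeff_monomial he, cons_inj]
  rw [Finset.sum_eq_single β]
  · split_ifs with h1 h2 h2
    · rw [map_one, one_mul]
    · exact absurd h1.1 h2
    · exact absurd ⟨h2, rfl⟩ h1
    · rw [map_zero, zero_mul]
  · intro γ _ hγ
    rw [if_neg fun h => hγ h.2.symm, map_zero, zero_mul]
  · intro h
    refine absurd (mem_degLE.mpr ?_) h
    rw [degree_cons]
    omega

theorem coeff_bullet_euler {φ : SubstMap A Δ (Coideal.dual α)}
    (hφ : ∀ β, φ.toAlgHom (monomial Δ β 1) =
      monomial _ (Finsupp.cons 0 β) 1 + monomial _ (Finsupp.cons 1 β) (β.degree : A)) (r : TPS R Δ)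
    {j : ℕ} {β : Fin p →₀ ℕ} (hj : j ≤ 1) (hβ : β ≤ α) :
    coeff (Finsupp.cons j β) (bullet ι φ r) =
      if j = 0 then coeff β r else β.degree • coeff β r := by
  have he : Finsupp.cons j β ∈ Coideal.dual α := Coideal.cons_mem_dual.mpr ⟨hj, hβ⟩
  rw [coeff_bullet _ _ _ he]
  simp only [hφ, coeff_add, coeff_monomial he, cons_inj]
  rw [Finset.sum_eq_single β]
  · rcases Nat.le_one_iff_eq_zero_or_eq_one.mp hj with rfl | rfl
    · simp
    · simp [nsmul_eq_mul]
  · intro γ _ hγ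
    rw [if_neg fun h => hγ h.2.symm, if_neg fun h => hγ h.2.symm, add_zero, map_zero, zero_mul]
  · intro h
    refine absurd (mem_degLE.mpr ?_) h
    rw [degree_cons]
    omega

theorem coeff_bullet_incl_mul {φ : SubstMap A Δ (Coideal.dual α)} (hα : α ∈ Δ)
    (hφ : ∀ β, φ.toAlgHom (monomial Δ β 1) = monomial _ (Finsupp.cons 0 β) 1) (r ε : TPS R Δ)
    {j : ℕ} {β : Fin p →₀ ℕ} (hj : j ≤ 1) (hβ : β ≤ α) :
    coeff (Finsupp.cons j β) (bullet ι φ r *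
      (1 + ∑ γ ∈ degLE p α.degree, monomial _ (Finsupp.cons 1 γ) (coeff γ ε))) =
      if j = 0 then coeff β r else coeff β (r * ε) := by
  have he : Finsupp.cons j β ∈ Coideal.dual α := Coideal.cons_mem_dual.mpr ⟨hj, hβ⟩
  rw [mul_add, mul_one, coeff_add, coeff_bullet_incl ι hφ r hj hβ, Finset.mul_sum, coeff_sum]
  simp only [coeff_mul_monomial he, cons_le_cons, cons_sub_cons]
  rcases Nat.le_one_iff_eq_zero_or_eq_one.mp hj with rfl | rfl
  · rw [if_pos rfl, if_pos rfl, Finset.sum_eq_zero, add_zero]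
    intro γ _
    rw [if_neg]
    rintro ⟨h, -⟩
    exact absurd h (by norm_num)
  -- Since β ≤ α, only the terms of ε of degree at most |α| contribute, so the finite sum may
  -- replace ε.
  · have h := mul_mem_highDeg r (sub_sum_monomial_mem_highDeg α.degree ε) β
      (Finsupp.degree_mono hβ)
    rw [mul_sub, coeff_sub, sub_eq_zero, Finset.mul_sum, coeff_sum] at h
    rw [if_neg one_ne_zero, if_neg one_ne_zero, zero_add, h]
    refine Finset.sum_congr rfl fun γ _ => ?_
    rw [coeff_mul_monomial (Coideal.mem_of_le hα hβ), Nat.sub_self]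
    by_cases hγ : γ ≤ β
    · rw [if_pos ⟨le_rfl, hγ⟩, if_pos hγ,
        coeff_bullet_incl ι hφ r zero_le_one (tsub_le_self.trans hβ), if_pos rfl]
    · rw [if_neg fun h => hγ h.2, if_neg hγ]

end Infinitesimal

/-! ### The LR-admissible map underlying a HS-structure -/

section Underlying

variable {k : Type u} {A : Type v} [CommRing k] [CommRing A] [Algebra k A] {p q : ℕ}
  {Δ : Coideal p} {Ω : Coideal q}
variable {R : Type w} [Ring R] [Algebra k R] {ι : A →ₐ[k] R}

open TPS

theorem HS.ext {D E : HS k A Δ} (h : D.1.val = E.1.val) : D = E := Subtype.ext (Units.ext h)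

theorem HS.val_mul (D E : HS k A Δ) : (D * E).1.val = D.1.val * E.1.val := rfl

theorem HS.val_ofDerivation (δ : Derivation k A A) : (HS.ofDerivation δ).1.val =
    1 + monomial Coideal.one (Finsupp.single 0 1) ((δ : A →ₗ[k] A) : Module.End k A) := rfl

theorem SubstMap.val_act (φ : SubstMap A Δ Ω) (D : HS k A Δ) :
    (φ.act D).1.val = bullet (leftAct k A A : A →+* Module.End k A) φ D.1.val := rfl

theorem SubstMap.val_act_ofDerivation (φ : SubstMap A Coideal.one Ω) {x : TPS A Ω}
    (hφ : φ.toAlgHom (monomial _ (Finsupp.single 0 1) 1) = x) (δ : Derivation k A A) :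
    (φ.act (HS.ofDerivation δ)).1.val = 1 + map Ω (leftAct k A A : A →+* Module.End k A) x *
      monomial Ω 0 ((δ : A →ₗ[k] A) : Module.End k A) := by
  rw [SubstMap.val_act, HS.val_ofDerivation, bullet_one_add_monomial, hφ]

theorem TPS.ext_one {x y : TPS R Coideal.one} (h0 : coeff 0 x = coeff 0 y)
    (h1 : coeff (Finsupp.single 0 1) x = coeff (Finsupp.single 0 1) y) : x = y := by
  refine TPS.ext fun α hα => ?_
  rcases Coideal.eq_of_mem_one hα with rfl | rfl
  · exact h0
  · exact h1

theorem TPS.coeff_one_mul (x y : TPS R Coideal.one) :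
    coeff (Finsupp.single 0 1) (x * y) =
      coeff 0 x * coeff (Finsupp.single 0 1) y + coeff (Finsupp.single 0 1) x * coeff 0 y := by
  rw [coeff_mul Coideal.single_mem_one, Finsupp.antidiagonal_single]
  simp [Finset.Nat.antidiagonal_succ]

theorem TPS.coeff_one_add_monomial (r : R) :
    coeff (Finsupp.single 0 1) (1 + monomial Coideal.one (Finsupp.single 0 1) r) = r := by
  rw [coeff_add, coeff_one Coideal.single_mem_one, if_neg single_zero_one_ne_zero,
    coeff_monomial Coideal.single_mem_one, if_pos rfl, zero_add]

theorem TPS.coeff_zero_one_add_monomial (r : R) :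
    coeff 0 (1 + monomial Coideal.one (Finsupp.single 0 1) r) = 1 := by
  rw [coeff_add, coeff_zero_one, coeff_monomial (Coideal.zero_mem _),
    if_neg single_zero_one_ne_zero.symm, add_zero]

/-- The co-ideal of the divisors of `s_0 s_1` in two variables. -/
noncomputable abbrev Coideal.square : Coideal 2 :=
  Coideal.below (Finsupp.single 0 1 + Finsupp.single 1 1)

/-- The z-term is killed by both variables. After expansion only the coefficient of s_0 s_1 differs,
so a group identity encodes z = [x, y]. -/
theorem TPS.commutator_iff (x y z : R) :
    (1 + monomial Coideal.square (Finsupp.single 0 1) x) *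
        (1 + monomial Coideal.square (Finsupp.single 1 1) y) =
      (1 + monomial Coideal.square (Finsupp.single 0 1 + Finsupp.single 1 1) z) *
        ((1 + monomial Coideal.square (Finsupp.single 1 1) y) *
          (1 + monomial Coideal.square (Finsupp.single 0 1) x)) ↔ x * y = z + y * x := by
  have h0 : monomial Coideal.square (Finsupp.single 0 1 + Finsupp.single 1 1) z *
      monomial Coideal.square (Finsupp.single 0 1) x = 0 := by
    rw [monomial_mul_monomial, monomial_of_notMem]
    intro h
    have h0 := h 0
    simp at h0
  have h1 : monomial Coideal.square (Finsupp.single 0 1 + Finsupp.single 1 1) z *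
      monomial Coideal.square (Finsupp.single 1 1) y = 0 := by
    rw [monomial_mul_monomial, monomial_of_notMem]
    intro h
    have h0 := h 1
    simp at h0
  have h2 : ∀ X Y Z : TPS R Coideal.square, Z * X = 0 → Z * Y = 0 →
      ((1 + X) * (1 + Y) = (1 + Z) * ((1 + Y) * (1 + X)) ↔ X * Y = Z + Y * X) := by
    intro X Y Z hX hY
    have h3 : (1 + Z) * ((1 + Y) * (1 + X)) = 1 + X + Y + (Z + Y * X) + Z * Y * (1 + X) + Z * X := by
      noncomm_ring
    have h4 : (1 + X) * (1 + Y) = 1 + X + Y + X * Y := by noncomm_ring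
    rw [h3, h4, hX, hY, zero_mul, add_zero, add_zero, add_right_inj]
  rw [h2 _ _ _ h0 h1, monomial_mul_monomial, monomial_mul_monomial,
    add_comm (Finsupp.single (1 : Fin 2) 1), ← TPS.monomial_add]
  constructor
  · intro h
    have h3 := congrArg (coeff (Finsupp.single 0 1 + Finsupp.single 1 1)) h
    have hmem : Finsupp.single (0 : Fin 2) 1 + Finsupp.single 1 1 ∈ Coideal.square :=
      Coideal.mem_below.mpr le_rfl
    rwa [coeff_monomial hmem, coeff_monomial hmem, if_pos rfl, if_pos rfl] at h3
  · intro h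
    rw [h]

/-- Values of f outside Δ, such as the unspecified ones of `HS.log`, are invisible because their
monomials vanish. -/
theorem TPS.monomial_cons_coeff_mk {α : Fin p →₀ ℕ} (hα : α ∈ Δ) (f : (Fin p →₀ ℕ) → R)
    (γ : Fin p →₀ ℕ) : monomial (Coideal.dual α) (Finsupp.cons 1 γ) (f γ) =
      monomial (Coideal.dual α) (Finsupp.cons 1 γ) (coeff γ (TPS.mk Δ f)) := by
  by_cases hγ : γ ∈ Δ
  · rw [coeff_mk hγ]
  · have h : Finsupp.cons 1 γ ∉ Coideal.dual α := fun h =>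
      hγ (Coideal.mem_of_le hα (Coideal.cons_mem_dual.mp h).2)
    rw [monomial_of_notMem h, monomial_of_notMem h]

namespace HSStructure

variable (Ψ : HSStructure ι)

theorem val_act (φ : SubstMap A Δ Ω) (D : HS k A Δ) : (Ψ.toHom Ω (φ.act D)).1.val =
    bullet (ι : A →+* R) φ (Ψ.toHom Δ D).1.val := Ψ.subst φ D

theorem val_mul (D E : HS k A Δ) : (Ψ.toHom Δ (D * E)).1.val =
    (Ψ.toHom Δ D).1.val * (Ψ.toHom Δ E).1.val := by
  rw [map_mul]
  rfl

/-- The operator `∇(δ)` defined by `Ψ(Id + δ s) = 1 + ∇(δ) s`. -/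
noncomputable def conn (δ : Derivation k A A) : R :=
  Ψ.comp (HS.ofDerivation δ) (Finsupp.single 0 1)

theorem val_ofDerivation (δ : Derivation k A A) :
    (Ψ.toHom Coideal.one (HS.ofDerivation δ)).1.val =
      1 + monomial Coideal.one (Finsupp.single 0 1) (Ψ.conn δ) := by
  refine TPS.ext_one ?_ ?_
  · rw [coeff_zero_one_add_monomial]
    exact (Ψ.toHom Coideal.one (HS.ofDerivation δ)).2
  · rw [coeff_one_add_monomial]
    rfl

theorem val_act_ofDerivation (φ : SubstMap A Coideal.one Ω) {x : TPS A Ω}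
    (hφ : φ.toAlgHom (monomial _ (Finsupp.single 0 1) 1) = x) (δ : Derivation k A A) :
    (Ψ.toHom Ω (φ.act (HS.ofDerivation δ))).1.val =
      1 + map Ω (ι : A →+* R) x * monomial Ω 0 (Ψ.conn δ) := by
  rw [Ψ.val_act, val_ofDerivation, bullet_one_add_monomial, hφ]

theorem conn_add (δ δ' : Derivation k A A) : Ψ.conn (δ + δ') = Ψ.conn δ + Ψ.conn δ' := by
  have h : HS.ofDerivation δ * HS.ofDerivation δ' = HS.ofDerivation (δ + δ') := by
    refine HS.ext (TPS.ext_one ?_ ?_)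
    · rw [HS.coeff_zero, HS.coeff_zero]
    · rw [HS.val_mul, HS.val_ofDerivation, HS.val_ofDerivation, HS.val_ofDerivation, coeff_one_mul]
      simp only [coeff_one_add_monomial, coeff_zero_one_add_monomial, one_mul, mul_one]
      rw [add_comm]
      rfl
  have h2 := congrArg (coeff (Finsupp.single 0 1)) (Ψ.val_mul (HS.ofDerivation δ) (HS.ofDerivation δ'))
  rw [h, Ψ.val_ofDerivation, Ψ.val_ofDerivation, Ψ.val_ofDerivation, coeff_one_mul] at h2
  simp only [coeff_one_add_monomial, coeff_zero_one_add_monomial, one_mul, mul_one] at h2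
  rw [h2, add_comm]

/-- The substitution s ↦ as takes Id + δs to Id + aδs. -/
theorem conn_smul (a : A) (δ : Derivation k A A) : Ψ.conn (a • δ) = ι a * Ψ.conn δ := by
  obtain ⟨φ, hφ⟩ := exists_substMap_one (Ω := Coideal.one)
    (x := monomial _ (Finsupp.single 0 1) a) (by
      rw [coeff_monomial (Coideal.zero_mem _), if_neg single_zero_one_ne_zero.symm]) (by
      rw [monomial_mul_monomial, monomial_of_notMem]
      intro h
      have h0 := h 0
      simp at h0)
  have h : φ.act (HS.ofDerivation δ) = HS.ofDerivation (a • δ) := by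
    refine HS.ext ?_
    rw [SubstMap.val_act_ofDerivation φ hφ, HS.val_ofDerivation, TPS.map_monomial,
      monomial_mul_monomial, add_zero]
    rfl
  have h2 := congrArg (coeff (Finsupp.single 0 1)) (Ψ.val_act_ofDerivation φ hφ δ)
  rw [h, Ψ.val_ofDerivation, TPS.map_monomial, monomial_mul_monomial, add_zero,
    coeff_one_add_monomial, coeff_one_add_monomial] at h2
  exact h2

theorem conn_leibniz (δ : Derivation k A A) (a : A) :
    Ψ.conn δ * ι a = ι a * Ψ.conn δ + ι (δ a) := by
  have h := Ψ.leibniz Coideal.one (HS.ofDerivation δ) a _ Coideal.single_mem_one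
  rw [Finsupp.antidiagonal_single, Ψ.val_ofDerivation, HS.val_ofDerivation] at h
  simpa [Finset.Nat.antidiagonal_succ, coeff_one_add_monomial, coeff_zero_one_add_monomial] using h

/-- Substituting s_0, s_1 and s_0 s_1 for s gives three Hasse–Schmidt derivations, and the bracket
becomes a relation between their products which Ψ preserves. -/
theorem conn_lie (δ δ' : Derivation k A A) : Ψ.conn ⁅δ, δ'⁆ = ⁅Ψ.conn δ, Ψ.conn δ'⁆ := by
  obtain ⟨φ, hφ⟩ := exists_substMap_one (A := A) (Ω := Coideal.square)
    (x := monomial _ (Finsupp.single 0 1) 1) (by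
      rw [coeff_monomial (Coideal.zero_mem _), if_neg (Finsupp.single_ne_zero.mpr one_ne_zero).symm]) (by
      rw [monomial_mul_monomial, ← Finsupp.single_add, monomial_of_notMem]
      intro h
      have h0 := h 0
      simp at h0)
  obtain ⟨ψ, hψ⟩ := exists_substMap_one (A := A) (Ω := Coideal.square)
    (x := monomial _ (Finsupp.single 1 1) 1) (by
      rw [coeff_monomial (Coideal.zero_mem _), if_neg (Finsupp.single_ne_zero.mpr one_ne_zero).symm]) (by
      rw [monomial_mul_monomial, ← Finsupp.single_add, monomial_of_notMem]
      intro h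
      have h0 := h 1
      simp at h0)
  obtain ⟨χ, hχ⟩ := exists_substMap_one (A := A) (Ω := Coideal.square)
    (x := monomial _ (Finsupp.single 0 1 + Finsupp.single 1 1) 1) (by
      rw [coeff_monomial (Coideal.zero_mem _), if_neg]
      intro h
      simpa using DFunLike.congr_fun h 0) (by
      rw [monomial_mul_monomial, monomial_of_notMem]
      intro h
      have h0 := h 0
      simp at h0)
  have hmap : ∀ (e : Fin 2 →₀ ℕ) (u : R), map Coideal.square (ι : A →+* R) (monomial _ e 1) *
      monomial _ 0 u = monomial _ e u := fun e u => by
    rw [TPS.map_monomial, map_one, ← monomial_eq_mul_const]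
  have hmap' : ∀ (e : Fin 2 →₀ ℕ) (u : Module.End k A),
      map Coideal.square (leftAct k A A : A →+* Module.End k A) (monomial _ e 1) *
      monomial _ 0 u = monomial _ e u := fun e u => by
    rw [TPS.map_monomial, map_one, ← monomial_eq_mul_const]
  have h : φ.act (HS.ofDerivation δ) * ψ.act (HS.ofDerivation δ') =
      χ.act (HS.ofDerivation ⁅δ, δ'⁆) *
        (ψ.act (HS.ofDerivation δ') * φ.act (HS.ofDerivation δ)) := by
    refine HS.ext ?_
    rw [HS.val_mul, HS.val_mul, HS.val_mul, SubstMap.val_act_ofDerivation φ hφ,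
      SubstMap.val_act_ofDerivation ψ hψ, SubstMap.val_act_ofDerivation χ hχ, hmap', hmap', hmap',
      TPS.commutator_iff]
    exact (sub_add_cancel _ _).symm
  have h2 := congrArg (fun E => (Ψ.toHom _ E).1.val) h
  simp only [Ψ.val_mul, Ψ.val_act_ofDerivation φ hφ, Ψ.val_act_ofDerivation ψ hψ,
    Ψ.val_act_ofDerivation χ hχ, hmap, TPS.commutator_iff] at h2
  rw [Ring.lie_def, h2, add_sub_cancel_right]

/-- The LR-admissible map underlying a HS-structure. -/
noncomputable def toLRAdmissible : LRAdmissible ι where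
  toFun := Ψ.conn
  map_add := Ψ.conn_add
  map_smul := Ψ.conn_smul
  leibniz := Ψ.conn_leibniz
  map_lie := Ψ.conn_lie

theorem hasUnderlying_toLRAdmissible : Ψ.HasUnderlying Ψ.toLRAdmissible := Ψ.val_ofDerivation

/-- Take the product of the series Id + δ_γ t s^γ, obtained from Id + δ_γ s by s ↦ t s^γ, so that Ψ
is known on each factor. As t² = 0 the product is additive. -/
theorem exists_infinitesimal (α : Fin p →₀ ℕ) (δ : (Fin p →₀ ℕ) → Derivation k A A)
    (S : Finset (Fin p →₀ ℕ)) : ∃ G : HS k A (Coideal.dual α),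
      G.1.val = 1 + ∑ γ ∈ S, monomial _ (Finsupp.cons 1 γ)
        ((δ γ : A →ₗ[k] A) : Module.End k A) ∧
      (Ψ.toHom _ G).1.val = 1 + ∑ γ ∈ S, monomial _ (Finsupp.cons 1 γ) (Ψ.conn (δ γ)) := by
  have hnot : ∀ β γ : Fin p →₀ ℕ, Finsupp.cons 1 β + Finsupp.cons 1 γ ∉ Coideal.dual α := by
    intro β γ h
    rw [cons_add_cons] at h
    exact absurd (Coideal.cons_mem_dual.mp h).1 (by norm_num)
  classical
  induction S using Finset.induction_on with
  | empty =>
    refine ⟨1, by rw [Finset.sum_empty, add_zero]; rfl, ?_⟩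
    rw [map_one, Finset.sum_empty, add_zero]
    rfl
  | insert β S hβ ih =>
    obtain ⟨G, hG, hΨG⟩ := ih
    obtain ⟨φ, hφ⟩ := exists_substMap_one (A := A) (Ω := Coideal.dual α)
      (x := monomial _ (Finsupp.cons 1 β) 1) (by
        rw [coeff_monomial (Coideal.zero_mem _), if_neg]
        exact (Finsupp.cons_ne_zero_of_left one_ne_zero).symm)
        (by rw [monomial_mul_monomial, monomial_of_notMem (hnot β β)])
    refine ⟨G * φ.act (HS.ofDerivation (δ β)), ?_, ?_⟩
    · rw [HS.val_mul, hG, SubstMap.val_act_ofDerivation φ hφ, TPS.map_monomial,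
        monomial_mul_monomial, add_zero, map_one, one_mul, mul_add, mul_one, add_mul, one_mul,
        Finset.sum_mul, Finset.sum_insert hβ, Finset.sum_eq_zero (f := fun i => _ * _), add_zero]
      · abel
      · intro γ _
        rw [monomial_mul_monomial, monomial_of_notMem (hnot γ β)]
    · rw [Ψ.val_mul, hΨG, Ψ.val_act_ofDerivation φ hφ, TPS.map_monomial,
        monomial_mul_monomial, add_zero, map_one, one_mul, mul_add, mul_one, add_mul, one_mul,
        Finset.sum_mul, Finset.sum_insert hβ, Finset.sum_eq_zero (f := fun i => _ * _), add_zero]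
      · abel
      · intro γ _
        rw [monomial_mul_monomial, monomial_of_notMem (hnot γ β)]

/-- A HS-structure commutes with logarithmic derivatives. -/
theorem chi_eq (D : HS k A Δ) : chi (Ψ.toHom Δ D).1.val =
    (Ψ.toHom Δ D).1.val * TPS.mk Δ fun α => Ψ.conn (HS.log D α) := by
  refine TPS.ext fun α hα => ?_
  obtain ⟨φ, hφ⟩ := exists_substMap_incl (A := A) hα
  obtain ⟨ψ, hψ⟩ := exists_substMap_euler (A := A) hα
  obtain ⟨G, hG, hΨG⟩ := Ψ.exists_infinitesimal α (HS.log D) (degLE p α.degree)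
  rw [Finset.sum_congr rfl fun γ _ => TPS.monomial_cons_coeff_mk hα
    (fun γ => ((HS.log D γ : A →ₗ[k] A) : Module.End k A)) γ] at hG
  rw [Finset.sum_congr rfl fun γ _ => TPS.monomial_cons_coeff_mk hα
    (fun γ => Ψ.conn (HS.log D γ)) γ] at hΨG
  -- This is D + tχ(D) = D(1 + tε) on the monomials below t s^α; applying Ψ and reading the
  -- coefficient of t s^α gives the claim.
  have h : ψ.act D = φ.act D * G := by
    refine HS.ext (TPS.ext fun e he => ?_)
    rw [← Finsupp.cons_tail e] at he ⊢
    obtain ⟨h1, h2⟩ := Coideal.cons_mem_dual.mp he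
    rw [HS.val_mul, SubstMap.val_act, SubstMap.val_act, hG, coeff_bullet_euler _ hψ _ h1 h2,
      coeff_bullet_incl_mul _ hα hφ _ _ h1 h2, ← HS.chi_eq, coeff_euler]
  have h2 := congrArg (fun E => coeff (Finsupp.cons 1 α) (Ψ.toHom _ E).1.val) h
  simp only [Ψ.val_mul, Ψ.val_act] at h2
  rwa [hΨG, coeff_bullet_euler _ hψ _ le_rfl le_rfl,
    coeff_bullet_incl_mul _ hα hφ _ _ le_rfl le_rfl, if_neg one_ne_zero, if_neg one_ne_zero,
    ← coeff_euler] at h2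

theorem conn_eq {nabla : LRAdmissible ι} (h : Ψ.HasUnderlying nabla) (δ : Derivation k A A) :
    nabla.toFun δ = Ψ.conn δ := by
  have h1 := congrArg (coeff (Finsupp.single 0 1)) ((h δ).symm.trans (Ψ.val_ofDerivation δ))
  rwa [coeff_one_add_monomial, coeff_one_add_monomial] at h1

/-- A HS-structure over a `ℚ`-algebra is determined by the underlying LR-admissible map. -/
theorem eq_of_conn_eq [Algebra ℚ k] {Ψ Φ : HSStructure ι} (h : ∀ δ, Ψ.conn δ = Φ.conn δ) :
    Ψ = Φ := by
  have h1 : ∀ {p : ℕ} (Δ : Coideal p) (D : HS k A Δ), Ψ.toHom Δ D = Φ.toHom Δ D := by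
    intro p Δ D
    have h2 := Φ.chi_eq D
    rw [← funext fun α => h (HS.log D α)] at h2
    exact Subtype.ext (Units.ext (chi_eq_mul_unique (k := k) (Ψ.chi_eq D) h2
      (coeff_zero_of_chi (Ψ.chi_eq D) (Ψ.toHom Δ D).2)
      ((Ψ.toHom Δ D).2.trans (Φ.toHom Δ D).2.symm)))
  obtain ⟨f, _, _⟩ := Ψ
  obtain ⟨g, _, _⟩ := Φ
  have h3 : @f = @g := by
    funext p Δ
    exact MonoidHom.ext (h1 Δ)
  subst h3
  rfl

end HSStructure

/-- Over a `ℚ`-algebra, every LR-admissible map underlies the HS-structure attached to it. -/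
theorem LRAdmissible.hasUnderlying_toHSStructure [Algebra ℚ k] (nabla : LRAdmissible ι) :
    nabla.toHSStructure.HasUnderlying nabla := by
  intro δ
  have h1 := HS.chi_eq (HS.ofDerivation δ)
  have h2 := nabla.chi_toHSStructure (HS.ofDerivation δ)
  have h10 := coeff_zero_of_chi h1 (HS.coeff_zero _)
  have h20 := coeff_zero_of_chi h2 (nabla.toHSStructure.toHom _ (HS.ofDerivation δ)).2
  have hV0 : coeff 0 (nabla.toHSStructure.toHom _ (HS.ofDerivation δ)).1.val = 1 :=
    (nabla.toHSStructure.toHom _ (HS.ofDerivation δ)).2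
  have h11 := congrArg (coeff (Finsupp.single 0 1)) h1
  have h21 := congrArg (coeff (Finsupp.single 0 1)) h2
  rw [coeff_euler, Finsupp.degree_single, one_smul, TPS.coeff_one_mul, h10, mul_zero, add_zero,
    HS.coeff_zero, one_mul, coeff_mk Coideal.single_mem_one, HS.val_ofDerivation,
    coeff_one_add_monomial] at h11
  -- In degree 1 the equation χ(D) = Dε says ε_1 = D_1 = δ.
  have hδ : HS.log (HS.ofDerivation δ) (Finsupp.single 0 1) = δ :=
    Derivation.ext fun a => (LinearMap.congr_fun h11 a).symm
  rw [coeff_euler, Finsupp.degree_single, one_smul, TPS.coeff_one_mul, h20, mul_zero, add_zero,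
    hV0, one_mul, coeff_mk Coideal.single_mem_one, hδ] at h21
  refine TPS.ext_one ?_ ?_
  · rw [coeff_zero_one_add_monomial, hV0]
  · rw [coeff_one_add_monomial, h21]

/-- Over a `ℚ`-algebra, every LR-admissible map underlies a unique HS-structure. -/
theorem existsUnique_hasUnderlying [Algebra ℚ k] (nabla : LRAdmissible ι) :
    ∃! Ψ : HSStructure ι, Ψ.HasUnderlying nabla := by
  refine ⟨nabla.toHSStructure, nabla.hasUnderlying_toHSStructure, fun Φ hΦ => ?_⟩
  refine HSStructure.eq_of_conn_eq fun δ => ?_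
  rw [← Φ.conn_eq hΦ, ← HSStructure.conn_eq _ nabla.hasUnderlying_toHSStructure]

theorem toHSStructure_toLRAdmissible [Algebra ℚ k] (Ψ : HSStructure ι) :
    Ψ.toLRAdmissible.toHSStructure = Ψ :=
  (existsUnique_hasUnderlying Ψ.toLRAdmissible).unique
    (LRAdmissible.hasUnderlying_toHSStructure _) Ψ.hasUnderlying_toLRAdmissible

theorem LRAdmissible.ext_toFun {nabla nabla' : LRAdmissible ι}
    (h : ∀ δ, nabla.toFun δ = nabla'.toFun δ) : nabla = nabla' := by
  obtain ⟨f, _, _, _, _⟩ := nabla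
  obtain ⟨g, _, _, _, _⟩ := nabla'
  obtain rfl : f = g := funext h
  rfl

theorem toLRAdmissible_toHSStructure [Algebra ℚ k] (nabla : LRAdmissible ι) :
    nabla.toHSStructure.toLRAdmissible = nabla :=
  LRAdmissible.ext_toFun fun δ =>
    (HSStructure.conn_eq _ nabla.hasUnderlying_toHSStructure δ).symm

/-- A subalgebra of `R × S` containing the pairs `(∇(δ), ∇'(δ))` contains the pairs of
coefficients of the HS-structures. -/
theorem HSStructure.comp_mem [Algebra ℚ k] {S : Type w} [Ring S] [Algebra k S] {κ : A →ₐ[k] S}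
    (Ψ : HSStructure ι) (Φ : HSStructure κ) (C : Subalgebra k (R × S))
    (hC : ∀ δ, (Ψ.conn δ, Φ.conn δ) ∈ C) (D : HS k A Δ) (α : Fin p →₀ ℕ) (hα : α ∈ Δ) :
    (Ψ.comp D α, Φ.comp D α) ∈ C := by
  induction hn : α.degree using Nat.strong_induction_on generalizing α with
  | _ n ih =>
    subst hn
    have h1 : TPS.coeff 0 (TPS.mk Δ fun α => Ψ.conn (HS.log D α)) = 0 :=
      coeff_zero_of_chi (Ψ.chi_eq D) (Ψ.toHom Δ D).2
    have h2 : TPS.coeff 0 (TPS.mk Δ fun α => Φ.conn (HS.log D α)) = 0 :=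
      coeff_zero_of_chi (Φ.chi_eq D) (Φ.toHom Δ D).2
    by_cases hc : α = 0
    · subst hc
      have h3 : (Ψ.comp D 0, Φ.comp D 0) = 1 := Prod.ext (Ψ.toHom Δ D).2 (Φ.toHom Δ D).2
      rw [h3]
      exact one_mem C
    refine mem_of_nsmul_mem (Subalgebra.toSubmodule C)
      (mt (Finsupp.degree_eq_zero_iff α).mp hc) ?_
    have h3 := congrArg (TPS.coeff α) (Ψ.chi_eq D)
    have h4 := congrArg (TPS.coeff α) (Φ.chi_eq D)
    rw [coeff_euler, coeff_mul hα] at h3 h4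
    -- Both structures obey a recursion driven by the same derivations, so the pairs satisfy one
    -- recursion in R × S, with driving terms in C.
    have h5 : α.degree • (Ψ.comp D α, Φ.comp D α) = ∑ c ∈ antidiagonal α,
        (Ψ.comp D c.1, Φ.comp D c.1) *
          (TPS.coeff c.2 (TPS.mk Δ fun α => Ψ.conn (HS.log D α)),
            TPS.coeff c.2 (TPS.mk Δ fun α => Φ.conn (HS.log D α))) := by
      refine Prod.ext ?_ ?_
      · rw [Prod.fst_sum]
        exact h3
      · rw [Prod.snd_sum]
        exact h4
    rw [h5]
    refine Submodule.sum_mem _ fun c hcα => ?_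
    by_cases hc2 : c.2 = 0
    · rw [hc2, h1, h2]
      convert Submodule.zero_mem _
      rw [Prod.mk_mul_mk, mul_zero, mul_zero]
      rfl
    · rw [coeff_mk (Coideal.mem_of_le hα (snd_le_of_mem hcα)),
        coeff_mk (Coideal.mem_of_le hα (snd_le_of_mem hcα))]
      refine C.mul_mem (ih _ ?_ c.1 (Coideal.mem_of_le hα (fst_le_of_mem hcα)) rfl) (hC _)
      rw [← mem_antidiagonal.mp hcα, _root_.map_add]
      have := mt (Finsupp.degree_eq_zero_iff c.2).mp hc2
      omega

end Underlying

/-! ### The isomorphisms of categories -/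

/-! ### Left modules. -/

section Left

variable (k : Type u) (A : Type v) [CommRing k] [CommRing A] [Algebra k A]

/-- The pairs of operators intertwined by an `A`-linear map, for left modules. -/
def leftIntertwiner {E F : Type w} [AddCommGroup E] [Module k E] [Module A E]
    [IsScalarTower k A E] [AddCommGroup F] [Module k F] [Module A F] [IsScalarTower k A F]
    (f : E →ₗ[A] F) : Subalgebra k (Module.End k E × Module.End k F) where
  carrier := {r | ∀ e, f (r.1 e) = r.2 (f e)}
  mul_mem' hr hs e := (hr _).trans (congrArg _ (hs e))
  add_mem' hr hs e := (map_add f _ _).trans (congrArg₂ (· + ·) (hr e) (hs e))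
  algebraMap_mem' c e := f.map_smul_of_tower c e

/-- The functor from left HS-modules to modules with a left integrable connection. -/
noncomputable def LeftHSModule.toConn : CategoryTheory.Functor (LeftHSModule.{u, v, w} k A)
    (LeftConnModule.{u, v, w} k A) where
  obj M := { carrier := M.carrier, nabla := M.hs.toLRAdmissible }
  map f :=
    { toLin := f.toLin
      comm := fun δ e => f.comm (HS.ofDerivation δ) _ Coideal.single_mem_one e }

/-- The functor from modules with a left integrable connection to left HS-modules. -/
noncomputable def LeftConnModule.toHS [Algebra ℚ k] :
    CategoryTheory.Functor (LeftConnModule.{u, v, w} k A) (LeftHSModule.{u, v, w} k A) where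
  obj N := { carrier := N.carrier, hs := N.nabla.toHSStructure }
  map {M N} f :=
    { toLin := f.toLin
      comm := fun D α hα => HSStructure.comp_mem M.nabla.toHSStructure N.nabla.toHSStructure
        (leftIntertwiner k A f.toLin)
        (fun δ e => by
          rw [← HSStructure.conn_eq _ M.nabla.hasUnderlying_toHSStructure,
            ← HSStructure.conn_eq _ N.nabla.hasUnderlying_toHSStructure]
          exact f.comm δ e) D α hα }

variable {k A}

/-- The round trip changes the structure only by a propositional equality. With h and h' as
variables these equalities can be substituted away, and equality of the underlying linear maps is
enough. -/
theorem LeftHSModule.hom_heq {M N : LeftHSModule.{u, v, w} k A}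
    {h : LeftHSStructure k A M.carrier} {h' : LeftHSStructure k A N.carrier} (hM : h = M.hs)
    (hN : h' = N.hs) (f : LeftHSModule.Hom M N)
    (g : LeftHSModule.Hom { carrier := M.carrier, hs := h } { carrier := N.carrier, hs := h' })
    (hfg : g.toLin = f.toLin) : HEq g f := by
  subst hM hN
  exact heq_of_eq (LeftHSModule.Hom.ext hfg)

theorem LeftConnModule.hom_heq {M N : LeftConnModule.{u, v, w} k A}
    {h : LeftConnection k A M.carrier} {h' : LeftConnection k A N.carrier} (hM : h = M.nabla)
    (hN : h' = N.nabla) (f : LeftConnModule.Hom M N)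
    (g : LeftConnModule.Hom { carrier := M.carrier, nabla := h }
      { carrier := N.carrier, nabla := h' })
    (hfg : g.toLin = f.toLin) : HEq g f := by
  subst hM hN
  exact heq_of_eq (LeftConnModule.Hom.ext hfg)

variable [Algebra ℚ k]

theorem LeftHSModule.toConn_comp_toHS :
    (LeftHSModule.toConn.{u, v, w} k A).comp (LeftConnModule.toHS k A) =
      CategoryTheory.Functor.id _ := by
  refine CategoryTheory.Functor.hext (fun M => ?_) (fun M N f => ?_)
  · exact congrArg (fun h => ({ carrier := M.carrier, hs := h } : LeftHSModule k A))
      (toHSStructure_toLRAdmissible M.hs)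
  · exact LeftHSModule.hom_heq (toHSStructure_toLRAdmissible M.hs)
      (toHSStructure_toLRAdmissible N.hs) f _ rfl

theorem LeftConnModule.toHS_comp_toConn :
    (LeftConnModule.toHS.{u, v, w} k A).comp (LeftHSModule.toConn k A) =
      CategoryTheory.Functor.id _ := by
  refine CategoryTheory.Functor.hext (fun M => ?_) (fun M N f => ?_)
  · exact congrArg (fun h => ({ carrier := M.carrier, nabla := h } : LeftConnModule k A))
      (toLRAdmissible_toHSStructure M.nabla)
  · exact LeftConnModule.hom_heq (toLRAdmissible_toHSStructure M.nabla)
      (toLRAdmissible_toHSStructure N.nabla) f _ rfl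

end Left

/-! ### Right modules: the same arguments over the opposite endomorphism algebras. -/

section Right

variable (k : Type u) (A : Type v) [CommRing k] [CommRing A] [Algebra k A]

/-- The pairs of operators intertwined by an `A`-linear map, for right modules. -/
def rightIntertwiner {E F : Type w} [AddCommGroup E] [Module k E] [Module A E]
    [IsScalarTower k A E] [AddCommGroup F] [Module k F] [Module A F] [IsScalarTower k A F]
    (f : E →ₗ[A] F) : Subalgebra k ((Module.End k E)ᵐᵒᵖ × (Module.End k F)ᵐᵒᵖ) where
  carrier := {r | ∀ e, f (MulOpposite.unop r.1 e) = MulOpposite.unop r.2 (f e)}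
  -- In the opposite algebra the left factor acts first, so `hr` and `hs` swap roles.
  mul_mem' hr hs e := (hs _).trans (congrArg _ (hr e))
  add_mem' hr hs e := (map_add f _ _).trans (congrArg₂ (· + ·) (hr e) (hs e))
  algebraMap_mem' c e := f.map_smul_of_tower c e

/-- The functor from right HS-modules to modules with a right integrable connection. -/
noncomputable def RightHSModule.toConn : CategoryTheory.Functor (RightHSModule.{u, v, w} k A)
    (RightConnModule.{u, v, w} k A) where
  obj M := { carrier := M.carrier, nabla := M.hs.toLRAdmissible }
  map f :=
    { toLin := f.toLin
      comm := fun δ e => f.comm (HS.ofDerivation δ) _ Coideal.single_mem_one e }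

/-- The functor from modules with a right integrable connection to right HS-modules. -/
noncomputable def RightConnModule.toHS [Algebra ℚ k] :
    CategoryTheory.Functor (RightConnModule.{u, v, w} k A) (RightHSModule.{u, v, w} k A) where
  obj N := { carrier := N.carrier, hs := N.nabla.toHSStructure }
  map {M N} f :=
    { toLin := f.toLin
      comm := fun D α hα => HSStructure.comp_mem M.nabla.toHSStructure N.nabla.toHSStructure
        (rightIntertwiner k A f.toLin)
        (fun δ e => by
          rw [← HSStructure.conn_eq _ M.nabla.hasUnderlying_toHSStructure,
            ← HSStructure.conn_eq _ N.nabla.hasUnderlying_toHSStructure]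
          exact f.comm δ e) D α hα }

variable {k A}

theorem RightHSModule.hom_heq {M N : RightHSModule.{u, v, w} k A}
    {h : RightHSStructure k A M.carrier} {h' : RightHSStructure k A N.carrier} (hM : h = M.hs)
    (hN : h' = N.hs) (f : RightHSModule.Hom M N)
    (g : RightHSModule.Hom { carrier := M.carrier, hs := h } { carrier := N.carrier, hs := h' })
    (hfg : g.toLin = f.toLin) : HEq g f := by
  subst hM hN
  exact heq_of_eq (RightHSModule.Hom.ext hfg)

theorem RightConnModule.hom_heq {M N : RightConnModule.{u, v, w} k A}
    {h : RightConnection k A M.carrier} {h' : RightConnection k A N.carrier} (hM : h = M.nabla)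
    (hN : h' = N.nabla) (f : RightConnModule.Hom M N)
    (g : RightConnModule.Hom { carrier := M.carrier, nabla := h }
      { carrier := N.carrier, nabla := h' })
    (hfg : g.toLin = f.toLin) : HEq g f := by
  subst hM hN
  exact heq_of_eq (RightConnModule.Hom.ext hfg)

variable [Algebra ℚ k]

theorem RightHSModule.toConn_comp_toHS :
    (RightHSModule.toConn.{u, v, w} k A).comp (RightConnModule.toHS k A) =
      CategoryTheory.Functor.id _ := by
  refine CategoryTheory.Functor.hext (fun M => ?_) (fun M N f => ?_)
  · exact congrArg (fun h => ({ carrier := M.carrier, hs := h } : RightHSModule k A))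
      (toHSStructure_toLRAdmissible M.hs)
  · exact RightHSModule.hom_heq (toHSStructure_toLRAdmissible M.hs)
      (toHSStructure_toLRAdmissible N.hs) f _ rfl

theorem RightConnModule.toHS_comp_toConn :
    (RightConnModule.toHS.{u, v, w} k A).comp (RightHSModule.toConn k A) =
      CategoryTheory.Functor.id _ := by
  refine CategoryTheory.Functor.hext (fun M => ?_) (fun M N f => ?_)
  · exact congrArg (fun h => ({ carrier := M.carrier, nabla := h } : RightConnModule k A))
      (toLRAdmissible_toHSStructure M.nabla)
  · exact RightConnModule.hom_heq (toLRAdmissible_toHSStructure M.nabla)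
      (toLRAdmissible_toHSStructure N.nabla) f _ rfl

end Right

end HSMod

theorem mainTheorem3 (k : Type u) (A : Type v) [CommRing k] [CommRing A] [Algebra k A]
    [Algebra ℚ k] :
    (∃ (F : CategoryTheory.Functor (HSMod.LeftHSModule.{u, v, w} k A)
          (HSMod.LeftConnModule.{u, v, w} k A))
        (G : CategoryTheory.Functor (HSMod.LeftConnModule.{u, v, w} k A)
          (HSMod.LeftHSModule.{u, v, w} k A)),
      F.comp G = CategoryTheory.Functor.id _ ∧
      G.comp F = CategoryTheory.Functor.id _ ∧
      F.comp (HSMod.LeftConnModule.forget k A) = HSMod.LeftHSModule.forget k A ∧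
      ∀ M : HSMod.LeftHSModule.{u, v, w} k A, ∃ nabla : HSMod.LeftConnection k A M.carrier,
        F.obj M = { carrier := M.carrier, nabla := nabla } ∧ M.hs.HasUnderlying nabla) ∧
    (∃ (F : CategoryTheory.Functor (HSMod.RightHSModule.{u, v, w} k A)
          (HSMod.RightConnModule.{u, v, w} k A))
        (G : CategoryTheory.Functor (HSMod.RightConnModule.{u, v, w} k A)
          (HSMod.RightHSModule.{u, v, w} k A)),
      F.comp G = CategoryTheory.Functor.id _ ∧
      G.comp F = CategoryTheory.Functor.id _ ∧
      F.comp (HSMod.RightConnModule.forget k A) = HSMod.RightHSModule.forget k A ∧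
      ∀ M : HSMod.RightHSModule.{u, v, w} k A, ∃ nabla : HSMod.RightConnection k A M.carrier,
        F.obj M = { carrier := M.carrier, nabla := nabla } ∧ M.hs.HasUnderlying nabla) ∧
    (∀ (E : Type w) [AddCommGroup E] [Module k E] [Module A E] [IsScalarTower k A E]
        (nabla : HSMod.LeftConnection k A E),
      ∃! Ψ : HSMod.LeftHSStructure k A E, Ψ.HasUnderlying nabla) ∧
    (∀ (E : Type w) [AddCommGroup E] [Module k E] [Module A E] [IsScalarTower k A E]
        (nabla : HSMod.RightConnection k A E),
      ∃! Ψ : HSMod.RightHSStructure k A E, Ψ.HasUnderlying nabla) := by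
  exact ⟨⟨HSMod.LeftHSModule.toConn k A, HSMod.LeftConnModule.toHS k A,
    HSMod.LeftHSModule.toConn_comp_toHS, HSMod.LeftConnModule.toHS_comp_toConn, rfl,
    fun M => ⟨M.hs.toLRAdmissible, rfl, M.hs.hasUnderlying_toLRAdmissible⟩⟩,
    ⟨HSMod.RightHSModule.toConn k A, HSMod.RightConnModule.toHS k A,
    HSMod.RightHSModule.toConn_comp_toHS, HSMod.RightConnModule.toHS_comp_toConn, rfl,
    fun M => ⟨M.hs.toLRAdmissible, rfl, M.hs.hasUnderlying_toLRAdmissible⟩⟩,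
    fun _ _ _ _ _ nabla => HSMod.existsUnique_hasUnderlying nabla,
    fun _ _ _ _ _ nabla => HSMod.existsUnique_hasUnderlying nabla⟩
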